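/- Let $d\in\{2,3\}$, let $\mathcal D\subset\mathbb R^d$ be bounded and open, $\kappa\ge 0$, $\Omega\in\mathbb R$, and let $W\in L^\infty(\mathcal D,\mathbb R)$. Let $R(x)=(x_2,-x_1)$ if $d=2$ and $R(x)=(x_2,-x_1,0)$ if $d=3$, and assume $W(x)\ge\Omega^2|R(x)|^2$ for a.e. $x\in\mathcal D$ (this holds in particular if $W(x)\ge\Omega^2|x|^2$). Let $V=H^1_0(\mathcal D;\mathbb C)$, regarded as a real Hilbert space with real dual $V^*$, let $(u,v)_H=\operatorname{Re}\int_{\mathcal D}u\bar v\,dx$, and let $\|\cdot\|$ be the $L^2(\mathcal D)$-norm. Put $\nabla_R v=\nabla v+\mathrm i\frac{\Omega}{2}Rv$, $W_R=W-\frac14\Omega^2|R|^2$, and, for $u,v,w\in V$ (with $u\neq0$ in the last two lines), $$E(u)=\frac12\int_{\mathcal D}|\nabla_R u|^2+W_R|u|^2+\frac{\kappa}{2}|u|^4\,dx,$$ $$\langle A(u,v),w\rangle=\operatorname{Re}\Big(\int_{\mathcal D}\nabla_R v\cdot\overline{\nabla_R w}+W_R v\bar w\,dx+\frac{\kappa}{\|u\|^2}\int_{\mathcal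 D}|u|^2v\bar w\,dx\Big),$$ $$\langle J(u)v,w\rangle=\operatorname{Re}\Big(\int_{\mathcal D}\nabla_R v\cdot\overline{\nabla_R w}+W_R v\bar w\,dx+\frac{\kappa}{\|u\|^2}\int_{\mathcal D}(u\bar v+2v\bar u)u\bar w\,dx-\frac{2\kappa(u,v)_H}{\|u\|^4}\int_{\mathcal D}|u|^2u\bar w\,dx\Big).$$ For $\sigma\in\mathbb R$ let $J_\sigma(u)=J(u)+\sigma\mathcal I:V\to V^*$, where $\langle\mathcal Iu,v\rangle=(u,v)_H$. Given step sizes $\tau_n>0$, the damped $J$-method with initial value $u^0$ and shift $\sigma$ is $$\tilde u^{n+1}=(1-\tau_n)u^n+\tau_n\gamma_n J_\sigma(u^n)^{-1}\mathcal Iu^n,\qquad u^{n+1}=\frac{\tilde u^{n+1}}{\|\tilde u^{n+1}\|},\qquad \gamma_n^{-1}=(J_\sigma(u^n)^{-1}\mathcal Iu^n,u^n)_H .$$ Let $u^0\in V$ with $\|u^0\|=1$. Then there is $\tau^*>0$, depending only on $u^0$ (and thereby on its domain $\mathcal D$) and on the value of the energy $E(u^0)$, but not otherwise on $\kappa,\Omega,W$,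 and not on $\sigma$, such that for every $\sigma\ge\frac43E(u^0)$ and every sequence of step sizes with $0<\tau_n\le\tau^*$ for all $n\ge 0$: 1. The damped $J$-method is well-posed: for every $n$, $J_\sigma(u^n):V\to V^*$ is bounded and linear with a bounded inverse, $(J_\sigma(u^n)^{-1}\mathcal Iu^n,u^n)_H\ne0$ and $\tilde u^{n+1}\neq0$, so the method defines a unique sequence $(u^n)_{n\ge0}$ in $V$. 2. $E(u^{n+1})\le E(u^n)\le E(u^0)$ for all $n\ge 0$. 3. $E(u^{n+1})<E(u^n)$ unless $u^n$ is already a critical point of $E$ on the manifold $\{u\in V:\|u\|=1\}$ (that is, $\frac{d}{dt}E(u^n+tv)|_{t=0}=0$ for all $v\in V$ with $(u^n,v)_H=0$) and an eigenstate (that is, there is $\lambda\in\mathbb R$ with $\langle A(u^n,u^n),v\rangle=\lambda(u^n,v)_H$ for all $v\in V$). -/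

import Mathlib

open MeasureTheory
open scoped ContDiff ComplexConjugate

noncomputable section

namespace GPE

/-- Points of the physical space `ℝ^d`. -/
abbrev Pt (d : ℕ) := EuclideanSpace ℝ (Fin d)

/-- `L²(D; ℂ)`. -/
abbrev L2 {d : ℕ} (D : Set (Pt d)) := Lp ℂ 2 (volume.restrict D)

/-- `L²(D; ℂ^d)`. -/
abbrev L2Vec {d : ℕ} (D : Set (Pt d)) :=
  Lp (EuclideanSpace ℂ (Fin d)) 2 (volume.restrict D)

/-- The classical gradient of a complex-valued function. -/
def classicalGrad {d : ℕ} (φ : Pt d → ℂ) (x : Pt d) : EuclideanSpace ℂ (Fin d) :=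
  WithLp.toLp 2 fun i => fderiv ℝ φ x (EuclideanSpace.single i 1)

/-- The real space `C_c^∞(D; ℂ)`. -/
def testFunctions {d : ℕ} (D : Set (Pt d)) : Submodule ℝ (Pt d → ℂ) where
  carrier := {φ | ContDiff ℝ ∞ φ ∧ HasCompactSupport φ ∧ tsupport φ ⊆ D}
  zero_mem' := by
    refine ⟨contDiff_const, HasCompactSupport.zero, ?_⟩
    rw [tsupport_eq_empty_iff.mpr rfl]
    exact Set.empty_subset D
  add_mem' := by
    rintro φ ψ ⟨h1, h2, h3⟩ ⟨k1, k2, k3⟩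
    exact ⟨h1.add k1, h2.add k2, (tsupport_add φ ψ).trans (Set.union_subset h3 k3)⟩
  smul_mem' := by
    rintro c φ ⟨h1, h2, h3⟩
    exact ⟨contDiff_const.smul h1, h2.smul_left (f := fun _ => c),
      (tsupport_smul_subset_right (fun _ => c) φ).trans h3⟩

/-- The graph `{(φ, ∇φ) : φ ∈ C_c^∞(D; ℂ)}` of the classical gradient, as a real subspace of
`L²(D; ℂ) × L²(D; ℂ^d)` with the Hilbert norm `(‖u‖² + ‖g‖²)^(1/2)`.  (The set of these pairs is
already a real subspace; the span only records this.) -/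
def testGraph {d : ℕ} (D : Set (Pt d)) : Submodule ℝ (WithLp 2 (L2 D × L2Vec D)) :=
  Submodule.span ℝ {p | ∃ φ ∈ testFunctions D,
    (p.fst : Pt d → ℂ) =ᵐ[volume.restrict D] φ ∧
    (p.snd : Pt d → EuclideanSpace ℂ (Fin d)) =ᵐ[volume.restrict D] classicalGrad φ}

/-- `H^1_0(D; ℂ)` as a real Hilbert space: the closure of `C_c^∞(D; ℂ)` in the `H^1`-norm.
An element is stored together with its (uniquely determined) weak gradient, as a pair
`(u, ∇u)` in `L²(D; ℂ) × L²(D; ℂ^d)`. On a bounded `D` its norm is equivalent to `‖∇u‖`. -/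
def H10 {d : ℕ} (D : Set (Pt d)) : Submodule ℝ (WithLp 2 (L2 D × L2Vec D)) :=
  (testGraph D).topologicalClosure

variable {d : ℕ} {D : Set (Pt d)}

/-- The function `u` itself. -/
def fn (u : H10 D) : Pt d → ℂ := (u.1.fst : L2 D)

/-- The weak gradient `∇u`. -/
def wgrad (u : H10 D) : Pt d → EuclideanSpace ℂ (Fin d) := (u.1.snd : L2Vec D)

/-- The `L²(D)`-norm of `u`. -/
def normH (u : H10 D) : ℝ := ‖(u.1.fst : L2 D)‖

/-- The real inner product `(u, v)_H = Re ∫_D u v̄`. -/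
def innerH (u v : H10 D) : ℝ := (∫ x in D, fn u x * conj (fn v x)).re

/-- The field `R(x,y) = (y,-x)` for `d = 2` and `R(x,y,z) = (y,-x,0)` for `d = 3`. -/
def rotField [NeZero d] (x : Pt d) : Pt d :=
  WithLp.toLp 2 fun i => if i = 0 then x 1 else if i = 1 then -x 0 else 0

/-- The rotational gradient `∇_R v = ∇v + i (Ω/2) R v`. -/
def rotGrad [NeZero d] (Ω : ℝ) (v : H10 D) (x : Pt d) : EuclideanSpace ℂ (Fin d) :=
  WithLp.toLp 2 fun i =>
    wgrad v x i + Complex.I * ((Ω / 2 : ℝ) : ℂ) * ((rotField x i : ℝ) : ℂ) * fn v x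

/-- The potential `W_R = W - Ω² |R|² / 4`, where `|R(x)|² = x₁² + x₂²`; thus
`|∇_R u|² + W_R |u|² = |∇u|² + W |u|² - Ω Re (ū L_z u)` with
`L_z = -i (x₁ ∂₂ - x₂ ∂₁)`. -/
def rotPot [NeZero d] (Ω : ℝ) (W : Pt d → ℝ) (x : Pt d) : ℝ :=
  W x - Ω ^ 2 * ‖rotField x‖ ^ 2 / 4

/-- The Gross-Pitaevskii energy
`E(u) = ½ ∫_D |∇_R u|² + W_R |u|² + (κ/2) |u|⁴`. -/
def energy [NeZero d] (κ Ω : ℝ) (W : Pt d → ℝ) (u : H10 D) : ℝ :=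
  (1 / 2) * ∫ x in D, (‖rotGrad Ω u x‖ ^ 2 + rotPot Ω W x * ‖fn u x‖ ^ 2
    + κ / 2 * ‖fn u x‖ ^ 4)

/-- The sesquilinear form `∫_D ∇_R v · conj (∇_R w) + W_R v w̄`. -/
def linForm [NeZero d] (Ω : ℝ) (W : Pt d → ℝ) (v w : H10 D) : ℂ :=
  ∫ x in D, ((∑ i, rotGrad Ω v x i * conj (rotGrad Ω w x i))
    + (rotPot Ω W x : ℂ) * fn v x * conj (fn w x))

/-- The Gross-Pitaevskii operator `⟨A(u,v), w⟩`. -/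
def opA [NeZero d] (κ Ω : ℝ) (W : Pt d → ℝ) (u v w : H10 D) : ℝ :=
  (linForm Ω W v w
    + ((κ / normH u ^ 2 : ℝ) : ℂ)
      * ∫ x in D, ((‖fn u x‖ ^ 2 : ℝ) : ℂ) * fn v x * conj (fn w x)).re

/-- The full linearized operator `⟨𝒥(u) v, w⟩`. -/
def fullJ [NeZero d] (κ Ω : ℝ) (W : Pt d → ℝ) (u v w : H10 D) : ℂ :=
  linForm Ω W v w
    + ((κ / normH u ^ 2 : ℝ) : ℂ)
      * (∫ x in D, (fn u x * conj (fn v x) + 2 * fn v x * conj (fn u x))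
          * fn u x * conj (fn w x))
    - ((2 * κ * innerH u v / normH u ^ 4 : ℝ) : ℂ)
      * ∫ x in D, ((‖fn u x‖ ^ 2 : ℝ) : ℂ) * fn u x * conj (fn w x)

/-- The form `⟨J_σ(u) v, w⟩ = ⟨J(u) v, w⟩ + σ (v, w)_H`, with `J = Re 𝒥`. -/
def formJ [NeZero d] (κ Ω : ℝ) (W : Pt d → ℝ) (σ : ℝ) (u v w : H10 D) : ℝ :=
  (fullJ κ Ω W u v w).re + σ * innerH v w

/-- `J_σ(u)` is a well-defined operator from `V = H^1_0(D)` to its real dual `V*`, and it is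
invertible with bounded inverse. -/
def JInvertible [NeZero d] (κ Ω : ℝ) (W : Pt d → ℝ) (σ : ℝ) (u : H10 D) : Prop :=
  ∃ J : H10 D ≃L[ℝ] (H10 D →L[ℝ] ℝ), ∀ v w : H10 D, J v w = formJ κ Ω W σ u v w

/-- The intermediate iterate `ũ = (1-τ) u + τ γ w`, `γ⁻¹ = (w, u)_H`, for `w = J_σ(u)⁻¹ I u`. -/
def intermediate (τ : ℝ) (u w : H10 D) : H10 D :=
  (1 - τ) • u + (τ * (innerH w u)⁻¹) • w

/-- `u'` is obtained from `u` by one step of the damped `J`-method with step size `τ` and shift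
`σ`, and this step is well defined: `J_σ(u)` is invertible, `γ` is finite and `ũ ≠ 0`. -/
def IsDampedJStep [NeZero d] (κ Ω : ℝ) (W : Pt d → ℝ) (σ τ : ℝ) (u u' : H10 D) : Prop :=
  JInvertible κ Ω W σ u ∧
  ∃ w : H10 D, (∀ v : H10 D, formJ κ Ω W σ u w v = innerH u v) ∧
    innerH w u ≠ 0 ∧
    normH (intermediate τ u w) ≠ 0 ∧
    u' = (normH (intermediate τ u w))⁻¹ • intermediate τ u w

/-- `u` is the sequence of iterates of the damped `J`-method with step sizes `τ n`. -/
def IsDampedJSequence [NeZero d] (κ Ω : ℝ) (W : Pt d → ℝ) (σ : ℝ) (τ : ℕ → ℝ) (u₀ : H10 D)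
    (u : ℕ → H10 D) : Prop :=
  u 0 = u₀ ∧ ∀ n, IsDampedJStep κ Ω W σ (τ n) (u n) (u (n + 1))

/-- `u` is a critical point of `E` on the manifold `{‖u‖ = 1}`: the derivative of `E` vanishes in
all tangential directions. -/
def IsCriticalPoint [NeZero d] (κ Ω : ℝ) (W : Pt d → ℝ) (u : H10 D) : Prop :=
  normH u = 1 ∧ ∀ v : H10 D, innerH u v = 0 →
    HasDerivAt (fun t : ℝ => energy κ Ω W (u + t • v)) 0 0

/-- `u` is an eigenstate: `‖u‖ = 1` and `⟨A(u,u), v⟩ = λ (u, v)_H` for all `v`. -/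
def IsEigenstate [NeZero d] (κ Ω : ℝ) (W : Pt d → ℝ) (u : H10 D) : Prop :=
  normH u = 1 ∧ ∃ eig : ℝ, ∀ v : H10 D, opA κ Ω W u u v = eig * innerH u v

end GPE

end

noncomputable section

namespace GPE

open Filter Topology
open scoped NNReal ENNReal RealInnerProductSpace

/-! With a the quadratic part of E, m the mass and P(u, v) = Re(u v̄) in real L²(D), the energy is a
quartic polynomial in the state. The descent argument uses only that a is coercive, that ‖P(u, v)‖²
≤ ⟪P(u, u), P(v, v)⟫, and a bound ‖P(v, v)‖ ≤ S a(v, v).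

On m(u, u) = 1 the only negative term of J_σ(u) is the normalization term. Completing a square costs
at most (4/3) E(u) m(v, v), which the shift pays for (`J_self_ge`). Hence J_σ(u) dominates a, and
Lax-Milgram inverts it.

One step moves along d = γ w - u, which is tangent to the sphere and satisfies J_σ(u) d = (γ - σ)
m(u, ·) - E'(u). Thus E'(u) d = -Q with Q = ⟨J_σ(u) d, d⟩ ≥ a(d, d), and for small τ the quadratic
to quartic terms of E(u + τ d) use up at most half of the gain τ Q (`energy_add_smul_le`). Since d
is tangent, u + τ d has mass at least 1, so normalizing scales it down and cannot raise the energy.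
If d = 0, then E'(u) is a multiple of m(u, ·), so u is an eigenstate and a critical point; otherwise
Q > 0 and the decrease is strict (`step_spec`).

The step bound involves κ S² and the energy level e. The constant S comes from the Sobolev
inequality and 3/4 ‖∇v‖² ≤ a(v, v), so it depends on D only (`three_fourths_norm_sq_le`). Since κ
‖u₀‖⁴ in L⁴ is at most 4 E(u₀), κ is itself bounded in terms of u₀ and e. -/

/-- The Hilbert space data behind the Gross-Pitaevskii energy
`E(u) = a(u, u) / 2 + κ ‖P(u, u)‖² / 4` on `m(u, u) = 1`. -/
structure EnergyForms (V G : Type*) [NormedAddCommGroup V] [InnerProductSpace ℝ V]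
    [NormedAddCommGroup G] [InnerProductSpace ℝ G] where
  /-- the quadratic part of the energy -/
  a : V →L[ℝ] V →L[ℝ] ℝ
  /-- the mass -/
  m : V →L[ℝ] V →L[ℝ] ℝ
  /-- the density -/
  P : V →L[ℝ] V →L[ℝ] G
  a_comm : ∀ u v, a u v = a v u
  m_comm : ∀ u v, m u v = m v u
  P_comm : ∀ u v, P u v = P v u
  m_nonneg : ∀ v, 0 ≤ m v v
  a_coercive : ∃ c, 0 < c ∧ ∀ v, c * ‖v‖ ^ 2 ≤ a v v
  norm_P_sq_le : ∀ u v, ‖P u v‖ ^ 2 ≤ ⟪P u u, P v v⟫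

/-! ### Abstract quartic energies: coercivity of the shifted linearization -/

namespace EnergyForms

variable {V G : Type*} [NormedAddCommGroup V] [InnerProductSpace ℝ V]
    [NormedAddCommGroup G] [InnerProductSpace ℝ G] (F : EnergyForms V G)

/-- The energy `E(u) = a(u, u) / 2 + κ ‖P(u, u)‖² / 4`. -/
def energy (κ : ℝ) (u : V) : ℝ := 1 / 2 * F.a u u + κ / 4 * ‖F.P u u‖ ^ 2

/-- The derivative `E'(u) v`. -/
def denergy (κ : ℝ) (u v : V) : ℝ := F.a u v + κ * ⟪F.P u u, F.P u v⟫

/-- The real inner product as a continuous bilinear map. -/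
def innerL (G : Type*) [NormedAddCommGroup G] [InnerProductSpace ℝ G] : G →L[ℝ] G →L[ℝ] ℝ :=
  (isBoundedBilinearMap_inner (𝕜 := ℝ) (E := G)).toContinuousLinearMap

@[simp]
lemma innerL_apply (x y : G) : innerL G x y = ⟪x, y⟫ := rfl

/-- The shifted linearization `J_σ(u)` at `u` with `m(u, u) = 1`. -/
def J (κ σ : ℝ) (u : V) : V →L[ℝ] V →L[ℝ] ℝ :=
  F.a
  + κ • ((2 : ℝ) • (innerL G).bilinearComp (F.P u) (F.P u)
      + (ContinuousLinearMap.compL ℝ V G ℝ (innerL G (F.P u u))).comp F.P)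
  - (2 * κ) • (F.m u).smulRight ((innerL G (F.P u u)).comp (F.P u))
  + σ • F.m

lemma J_apply (κ σ : ℝ) (u v w : V) :
    F.J κ σ u v w = F.a v w + κ * (2 * ⟪F.P u v, F.P u w⟫ + ⟪F.P u u, F.P v w⟫)
      - 2 * κ * (F.m u v * ⟪F.P u u, F.P u w⟫) + σ * F.m v w := by
  simp [J]
  ring

lemma a_nonneg (v : V) : 0 ≤ F.a v v := by
  obtain ⟨c, hc, h⟩ := F.a_coercive
  exact (by positivity : 0 ≤ c * ‖v‖ ^ 2).trans (h v)

lemma eq_zero_of_a_eq_zero {v : V} (hv : F.a v v = 0) : v = 0 := by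
  obtain ⟨c, hc, h⟩ := F.a_coercive
  have h1 := h v
  rw [hv] at h1
  have h2 : ‖v‖ ^ 2 ≤ 0 := by
    by_contra h3
    push Not at h3
    nlinarith [mul_pos hc h3]
  exact norm_eq_zero.1 (pow_eq_zero_iff two_ne_zero |>.1 (le_antisymm h2 (by positivity)))

lemma energy_nonneg {κ : ℝ} (hκ : 0 ≤ κ) (u : V) : 0 ≤ F.energy κ u := by
  have := F.a_nonneg u
  unfold energy
  positivity

lemma mul_norm_sq_le_energy {κ : ℝ} (u : V) : κ * ‖F.P u u‖ ^ 2 ≤ 4 * F.energy κ u := by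
  have := F.a_nonneg u
  unfold energy
  linarith

lemma m_sq_le {u : V} (hu : F.m u u = 1) (v : V) : F.m u v ^ 2 ≤ F.m v v := by
  have h := F.m_nonneg (v - F.m u v • u)
  simp only [map_sub, map_smul, sub_apply, smul_apply,
    smul_eq_mul, hu, F.m_comm v u] at h
  nlinarith

/-- With s = ‖P(u, v)‖, p = ‖P(u, u)‖ and t = |m(u, v)|, the κ-terms are at least κ(3s² - 2tps) ≥ -κ
p² t² / 3. Here κ p² ≤ 4 E(u) and t² ≤ m(v, v), which produces the factor 4/3. -/
lemma J_self_ge {κ : ℝ} (hκ : 0 ≤ κ) (σ : ℝ) {u : V} (hu : F.m u u = 1) (v : V) :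
    F.a v v + (σ - 4 / 3 * F.energy κ u) * F.m v v ≤ F.J κ σ u v v := by
  rw [J_apply, real_inner_self_eq_norm_sq]
  have h1 := F.norm_P_sq_le u v
  have h2 := F.m_sq_le hu v
  have h3 : F.m u v * ⟪F.P u u, F.P u v⟫ ≤ |F.m u v| * (‖F.P u u‖ * ‖F.P u v‖) := by
    refine (le_abs_self _).trans ?_
    rw [abs_mul]
    exact mul_le_mul_of_nonneg_left (abs_real_inner_le_norm _ _) (abs_nonneg _)
  have h4 := F.mul_norm_sq_le_energy (κ := κ) u
  have h5 := F.energy_nonneg hκ u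
  rw [← sq_abs] at h2
  set t := |F.m u v|
  set p := ‖F.P u u‖
  set s := ‖F.P u v‖
  have h6 : κ * p ^ 2 * t ^ 2 ≤ 4 * F.energy κ u * F.m v v :=
    (mul_le_mul_of_nonneg_right h4 (sq_nonneg t)).trans
      (mul_le_mul_of_nonneg_left h2 (by linarith))
  have h7 := mul_le_mul_of_nonneg_left h1 hκ
  have h8 := mul_le_mul_of_nonneg_left h3 hκ
  -- Three times the completed square: (3s - tp)² / 3 = 3s² - 2tps + t²p² / 3.
  have h9 : 0 ≤ κ * (3 * s - t * p) ^ 2 := by positivity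
  nlinarith

lemma J_self_ge_a {κ σ e : ℝ} (hκ : 0 ≤ κ) {u : V} (hu : F.m u u = 1)
    (he : F.energy κ u ≤ e) (hσ : 4 / 3 * e ≤ σ) (v : V) : F.a v v ≤ F.J κ σ u v v := by
  have h1 := F.J_self_ge hκ σ hu v
  have h2 := mul_nonneg (by linarith : 0 ≤ σ - 4 / 3 * F.energy κ u) (F.m_nonneg v)
  linarith

/-- The Lax-Milgram theorem, as a statement on the operator into the dual space. -/
lemma exists_equiv_dual [CompleteSpace V] {B : V →L[ℝ] V →L[ℝ] ℝ} (hB : IsCoercive B) :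
    ∃ e : V ≃L[ℝ] (V →L[ℝ] ℝ), ∀ v w, e v w = B v w := by
  refine ⟨ContinuousLinearEquiv.ofBijective B ?_ ?_, fun v w => rfl⟩
  · rw [LinearMap.ker_eq_bot']
    intro v hv
    obtain ⟨C, hC, h⟩ := hB
    have h1 := h v
    have h2 : B v = 0 := hv
    rw [h2, zero_apply] at h1
    by_contra h3
    have h4 : 0 < ‖v‖ := norm_pos_iff.2 h3
    nlinarith [mul_pos (mul_pos hC h4) h4]
  · rw [LinearMap.range_eq_top]
    intro f
    refine ⟨hB.continuousLinearEquivOfBilin.symm ((InnerProductSpace.toDual ℝ V).symm f), ?_⟩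
    ext w
    have := hB.continuousLinearEquivOfBilin_apply
      (hB.continuousLinearEquivOfBilin.symm ((InnerProductSpace.toDual ℝ V).symm f)) w
    rw [ContinuousLinearEquiv.apply_symm_apply, InnerProductSpace.toDual_symm_apply] at this
    exact this.symm

lemma J_isCoercive {κ σ e : ℝ} (hκ : 0 ≤ κ) {u : V} (hu : F.m u u = 1)
    (he : F.energy κ u ≤ e) (hσ : 4 / 3 * e ≤ σ) : IsCoercive (F.J κ σ u) := by
  obtain ⟨c, hc, h⟩ := F.a_coercive
  refine ⟨c, hc, fun v => ?_⟩
  rw [mul_assoc, ← sq]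
  exact (h v).trans (F.J_self_ge_a hκ hu he hσ v)

/-! ### Energy along a line and the decrease in one step -/

lemma energy_add_smul (κ t : ℝ) (u v : V) :
    F.energy κ (u + t • v) = F.energy κ u + t * F.denergy κ u v
      + t ^ 2 / 2 * (F.a v v + κ * (2 * ‖F.P u v‖ ^ 2 + ⟪F.P u u, F.P v v⟫))
      + t ^ 3 * (κ * ⟪F.P u v, F.P v v⟫) + t ^ 4 * (κ / 4 * ‖F.P v v‖ ^ 2) := by
  simp only [energy, denergy, ← real_inner_self_eq_norm_sq, map_add, map_smul,
    add_apply, smul_apply, smul_eq_mul, F.a_comm v u,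
    F.P_comm v u, inner_add_left, inner_add_right, real_inner_smul_left, real_inner_smul_right,
    real_inner_comm (F.P u u) (F.P u v), real_inner_comm (F.P v v) (F.P u v),
    real_inner_comm (F.P u u) (F.P v v)]
  ring

lemma hasDerivAt_energy (κ : ℝ) (u v : V) :
    HasDerivAt (fun t : ℝ => F.energy κ (u + t • v)) (F.denergy κ u v) 0 := by
  simp only [energy_add_smul]
  generalize F.denergy κ u v = b
  generalize F.energy κ u = c₀
  generalize (F.a v v + κ * (2 * ‖F.P u v‖ ^ 2 + ⟪F.P u u, F.P v v⟫)) = c₂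
  generalize (κ * ⟪F.P u v, F.P v v⟫) = c₃
  generalize (κ / 4 * ‖F.P v v‖ ^ 2) = c₄
  have h := ((((hasDerivAt_id (0 : ℝ)).mul_const b).const_add c₀).add
    ((((hasDerivAt_id (0 : ℝ)).pow 2).div_const 2).mul_const c₂)).add
    (((hasDerivAt_id (0 : ℝ)).pow 3).mul_const c₃) |>.add
    (((hasDerivAt_id (0 : ℝ)).pow 4).mul_const c₄)
  exact h.congr_deriv (by simp)

lemma hasDerivAt_of_eq_energy {κ : ℝ} {f : V → ℝ} (hf : ∀ u, f u = F.energy κ u) (u v : V) :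
    HasDerivAt (fun t : ℝ => f (u + t • v)) (F.denergy κ u v) 0 := by
  simp only [hf]
  exact F.hasDerivAt_energy κ u v

lemma energy_smul (κ c : ℝ) (u : V) :
    F.energy κ (c • u) = c ^ 2 * (1 / 2 * F.a u u) + c ^ 4 * (κ / 4 * ‖F.P u u‖ ^ 2) := by
  simp only [energy, ← real_inner_self_eq_norm_sq, map_smul,
    smul_apply, smul_eq_mul, real_inner_smul_left, real_inner_smul_right]
  ring

/-- Makes the normalization harmless: the intermediate iterate has mass at least 1, so dividing by
its norm is such a scaling. -/
lemma energy_smul_le {κ c : ℝ} (hκ : 0 ≤ κ) (hc : 0 ≤ c) (hc1 : c ≤ 1) (u : V) :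
    F.energy κ (c • u) ≤ F.energy κ u := by
  rw [energy_smul]
  have h2 : c ^ 2 ≤ 1 := pow_le_one₀ hc hc1
  have h4 : c ^ 4 ≤ 1 := pow_le_one₀ hc hc1
  have := F.a_nonneg u
  unfold energy
  exact add_le_add (mul_le_of_le_one_left (by positivity) h2)
    (mul_le_of_le_one_left (by positivity) h4)

lemma a_sq_le (u v : V) : F.a u v ^ 2 ≤ F.a u u * F.a v v := by
  have h : ∀ t : ℝ, 0 ≤ F.a v v * (t * t) + 2 * F.a u v * t + F.a u u := by
    intro t
    have h := F.a_nonneg (u + t • v)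
    simp only [map_add, map_smul, add_apply, smul_apply,
      smul_eq_mul, F.a_comm v u] at h
    linarith
  have := discrim_le_zero h
  unfold discrim at this
  linarith

/-- Cauchy-Schwarz for the pair (a, κ⟪·,·⟫), combined with a(u, u) + κ‖P(u, u)‖² ≤ 4 E(u). It yields
an a priori bound on the search direction. -/
lemma denergy_sq_le {κ : ℝ} (hκ : 0 ≤ κ) (u v : V) :
    F.denergy κ u v ^ 2 ≤ 4 * F.energy κ u * (F.a v v + κ * ‖F.P u v‖ ^ 2) := by
  have h1 := F.a_sq_le u v
  have h2 : ⟪F.P u u, F.P u v⟫ ^ 2 ≤ ‖F.P u u‖ ^ 2 * ‖F.P u v‖ ^ 2 := by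
    rw [← mul_pow]
    exact sq_le_sq' (neg_le_of_abs_le (abs_real_inner_le_norm _ _)) (real_inner_le_norm _ _)
  have hu := F.a_nonneg u
  have hv := F.a_nonneg v
  unfold denergy energy
  set x := F.a u v
  set y := ⟪F.P u u, F.P u v⟫
  set p := ‖F.P u u‖ ^ 2
  set s := ‖F.P u v‖ ^ 2
  have hp : 0 ≤ p := by positivity
  have hs : 0 ≤ s := by positivity
  have h3 : 2 * (x * y) ≤ F.a u u * s + p * F.a v v := by
    refine le_of_sq_le_sq ?_ (by positivity)
    have h4 : x ^ 2 * y ^ 2 ≤ F.a u u * F.a v v * (p * s) :=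
      mul_le_mul h1 h2 (sq_nonneg y) (by positivity)
    nlinarith [sq_nonneg (F.a u u * s - p * F.a v v)]
  have h5 := mul_le_mul_of_nonneg_left h3 hκ
  have h6 := mul_le_mul_of_nonneg_left h2 (sq_nonneg κ)
  have h7 : 0 ≤ F.a u u * (F.a v v + κ * s) := by positivity
  nlinarith

/-- At v = u the coefficients of the κ-term add up to 2 + 1 - 2 = 1, which is exactly the
nonlinearity of E'(u). -/
lemma J_base (κ σ : ℝ) {u : V} (hu : F.m u u = 1) (v : V) :
    F.J κ σ u u v = F.denergy κ u v + σ * F.m u v := by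
  rw [J_apply, denergy, hu]
  ring

/-- The linear term is -τ Q with Q = ⟨J_σ(u) d, d⟩. Each higher coefficient is bounded by a multiple
of Q involving K alone, so the step restriction does not see σ. -/
lemma energy_add_smul_le {κ σ e S K τ : ℝ} (hκ : 0 ≤ κ) {u d : V}
    (he : F.energy κ u ≤ e) (hσ : 4 / 3 * e ≤ σ) (hS : ∀ v, ‖F.P v v‖ ≤ S * F.a v v)
    (hK : κ * S ^ 2 * (4 * e) ≤ K) (hτ : 0 < τ) (hτK : τ * (2 * (1 + K)) ≤ 1)
    (hd : F.m u d = 0) (hJ : F.J κ σ u d d = -F.denergy κ u d) :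
    F.energy κ (u + τ • d) ≤ F.energy κ u - τ / 2 * F.J κ σ u d d := by
  have he0 := (F.energy_nonneg hκ u).trans he
  have hK0 : 0 ≤ K := (by positivity : 0 ≤ κ * S ^ 2 * (4 * e)).trans hK
  have ha := F.a_nonneg d
  have hD := F.denergy_sq_le hκ u d
  have hE : F.denergy κ u d = -F.J κ σ u d d := by rw [hJ, neg_neg]
  have hq := F.norm_P_sq_le u d
  have hm := mul_nonneg (by linarith : 0 ≤ σ) (F.m_nonneg d)
  have hr := hS d
  have hi := real_inner_le_norm (F.P u d) (F.P d d)
  have hQ := F.J_apply κ σ u d d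
  rw [hd, zero_mul, mul_zero, sub_zero, real_inner_self_eq_norm_sq] at hQ
  rw [energy_add_smul, hE]
  rw [hE, neg_sq] at hD
  set Q := F.J κ σ u d d
  set a := F.a d d
  set s := ‖F.P u d‖
  set r := ‖F.P d d‖
  set q := ⟪F.P u u, F.P d d⟫
  have hr0 : 0 ≤ r := norm_nonneg _
  have hs2 : 0 ≤ κ * s ^ 2 := by positivity
  have hκq := mul_le_mul_of_nonneg_left hq hκ
  have hQs : a + κ * s ^ 2 ≤ Q := by nlinarith
  have hQ0 : 0 ≤ Q := by linarith
  -- From Q² = (E'(u) d)² ≤ 4e (a + κs²) ≤ 4e Q. This makes the direction bounded independently of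
  -- σ.
  have hQe : Q ≤ 4 * e := by
    by_contra! h
    have h1 : 4 * F.energy κ u * (a + κ * s ^ 2) ≤ 4 * e * Q :=
      mul_le_mul (by linarith) hQs (by linarith) (by linarith)
    nlinarith
  -- The quartic term in d becomes linear in Q: r ≤ S a, then one factor a is bounded by 4e and the
  -- other by Q.
  have hrK : κ * r ^ 2 ≤ K * Q := by
    have h1 : r ^ 2 ≤ S ^ 2 * (4 * e * Q) := by
      calc r ^ 2 ≤ (S * a) ^ 2 := by gcongr
        _ = S ^ 2 * (a * a) := by ring
        _ ≤ S ^ 2 * (4 * e * Q) := by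
          have : a * a ≤ 4 * e * Q := mul_le_mul (by linarith) (by linarith) ha (by linarith)
          gcongr
    calc κ * r ^ 2 ≤ κ * (S ^ 2 * (4 * e * Q)) := by gcongr
      _ = κ * S ^ 2 * (4 * e) * Q := by ring
      _ ≤ K * Q := by gcongr
  have h3 : κ * ⟪F.P u d, F.P d d⟫ ≤ (1 + K) * Q / 2 := by
    have h1 := mul_le_mul_of_nonneg_left hi hκ
    have h2 : 0 ≤ κ * (s - r) ^ 2 := by positivity
    nlinarith
  have hτ1 : τ ≤ 1 / 2 := by nlinarith [mul_nonneg hτ.le hK0]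
  have hτ2 : τ * (1 + K) ≤ 1 / 2 := by linarith
  have hτQ : 0 ≤ τ * Q := by positivity
  have t2 : τ ^ 2 / 2 * (a + κ * (2 * s ^ 2 + q)) ≤ τ * Q / 4 := by
    have h1 : a + κ * (2 * s ^ 2 + q) ≤ Q := by linarith
    calc _ ≤ τ ^ 2 / 2 * Q := by gcongr
      _ = τ * (τ * Q) / 2 := by ring
      _ ≤ 1 / 2 * (τ * Q) / 2 := by gcongr
      _ = τ * Q / 4 := by ring
  have t3 : τ ^ 3 * (κ * ⟪F.P u d, F.P d d⟫) ≤ τ * Q / 8 := by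
    calc _ ≤ τ ^ 3 * ((1 + K) * Q / 2) := by gcongr
      _ = τ * (τ * (1 + K)) * (τ * Q) / 2 := by ring
      _ ≤ 1 / 2 * (1 / 2) * (τ * Q) / 2 := by gcongr
      _ = τ * Q / 8 := by ring
  have t4 : τ ^ 4 * (κ / 4 * r ^ 2) ≤ τ * Q / 32 := by
    calc _ = τ ^ 4 * (κ * r ^ 2) / 4 := by ring
      _ ≤ τ ^ 4 * (K * Q) / 4 := by gcongr
      _ = τ * τ * (τ * K) * (τ * Q) / 4 := by ring
      _ ≤ 1 / 2 * (1 / 2) * (1 / 2) * (τ * Q) / 4 := by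
        have : τ * K ≤ 1 / 2 := by nlinarith
        gcongr
      _ = τ * Q / 32 := by ring
  -- The remainders add up to (1/4 + 1/8 + 1/32) τ Q = (13/32) τ Q, below half of the gain τ Q.
  linarith

/-- One step of the damped method is well defined and decreases the energy, strictly so unless
the current iterate is an eigenstate. -/
lemma step_spec {κ σ e S K τ : ℝ} (hκ : 0 ≤ κ) {u w : V} (hu : F.m u u = 1)
    (he : F.energy κ u ≤ e) (hσ : 4 / 3 * e ≤ σ) (hS : ∀ v, ‖F.P v v‖ ≤ S * F.a v v)
    (hK : κ * S ^ 2 * (4 * e) ≤ K) (hτ : 0 < τ) (hτK : τ * (2 * (1 + K)) ≤ 1)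
    (hw : ∀ v, F.J κ σ u w v = F.m u v) :
    0 < F.m w u ∧
      1 ≤ F.m ((1 - τ) • u + (τ * (F.m w u)⁻¹) • w) ((1 - τ) • u + (τ * (F.m w u)⁻¹) • w) ∧
      ∀ c : ℝ, 0 ≤ c → c ≤ 1 →
        F.energy κ (c • ((1 - τ) • u + (τ * (F.m w u)⁻¹) • w)) ≤ F.energy κ u ∧
        ((¬ ∃ eig : ℝ, ∀ v, F.denergy κ u v = eig * F.m u v) →
          F.energy κ (c • ((1 - τ) • u + (τ * (F.m w u)⁻¹) • w)) < F.energy κ u) := by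
  have hw0 : w ≠ 0 := by
    rintro rfl
    have := hw u
    simp [hu] at this
  have hwu : 0 < F.m w u := by
    rw [F.m_comm, ← hw]
    -- γ⁻¹ = m(u, w) = ⟨J_σ(u) w, w⟩ ≥ a(w, w) > 0.
    refine lt_of_lt_of_le ?_ (F.J_self_ge_a hκ hu he hσ w)
    exact lt_of_le_of_ne (F.a_nonneg w) fun h => hw0 (F.eq_zero_of_a_eq_zero h.symm)
  have hγ : (F.m w u)⁻¹ * F.m w u = 1 := inv_mul_cancel₀ hwu.ne'
  set γ := (F.m w u)⁻¹
  set d := γ • w - u with hd_def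
  have hz : (1 - τ) • u + (τ * γ) • w = u + τ • d := by
    rw [hd_def]
    module
  have hd : F.m u d = 0 := by
    rw [hd_def, map_sub, map_smul, smul_eq_mul, F.m_comm u w, hγ, hu, sub_self]
  have hJ : ∀ v, F.J κ σ u d v = (γ - σ) * F.m u v - F.denergy κ u v := by
    intro v
    rw [hd_def, map_sub, map_smul, sub_apply, smul_apply, hw, J_base _ _ _ hu,
      smul_eq_mul]
    ring
  have hJd : F.J κ σ u d d = -F.denergy κ u d := by rw [hJ, hd, mul_zero, zero_sub]
  have hmain := F.energy_add_smul_le hκ he hσ hS hK hτ hτK hd hJd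
  have hge := F.J_self_ge_a hκ hu he hσ d
  have hτa : 0 ≤ τ / 2 * F.J κ σ u d d :=
    mul_nonneg (by positivity) ((F.a_nonneg d).trans hge)
  rw [hz]
  refine ⟨hwu, ?_, fun c hc hc1 => ⟨?_, fun hne => ?_⟩⟩
  -- By tangency m(u + τ d, u + τ d) = 1 + τ² m(d, d).
  · have := F.m_nonneg (τ • d)
    simp only [map_add, map_smul, add_apply, smul_apply, smul_eq_mul, hu, hd,
      F.m_comm d u] at this ⊢
    linarith
  · linarith [F.energy_smul_le hκ hc hc1 (u + τ • d)]
  · have hd0 : d ≠ 0 := by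
      intro h0
      -- A vanishing direction turns the equation for d into E'(u) = (γ - σ) m(u, ·).
      refine hne ⟨γ - σ, fun v => ?_⟩
      have := hJ v
      rw [h0, map_zero, zero_apply] at this
      linarith
    have hpos : 0 < F.a d d :=
      lt_of_le_of_ne (F.a_nonneg d) fun h => hd0 (F.eq_zero_of_a_eq_zero h.symm)
    have := mul_pos (half_pos hτ) (hpos.trans_le hge)
    linarith [F.energy_smul_le hκ hc hc1 (u + τ • d)]

/-! ### The abstract iteration -/

/-- The quartic part of the energy is controlled by the quadratic part. -/
def DensityBound (S : ℝ) : Prop := ∀ v, ‖F.P v v‖ ≤ S * F.a v v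

/-- The value `a(u, v)`. -/
def aForm (u v : V) : ℝ := F.a u v

/-- The value `m(u, v)`. -/
def mForm (u v : V) : ℝ := F.m u v

/-- The value `⟪P(u, v), P(w, z)⟫`. -/
def PForm (u v w z : V) : ℝ := ⟪F.P u v, F.P w z⟫

lemma energy_eq_forms (κ : ℝ) (u : V) :
    F.energy κ u = 1 / 2 * F.aForm u u + κ / 4 * F.PForm u u u u := by
  rw [energy, aForm, PForm, real_inner_self_eq_norm_sq]

lemma denergy_eq_forms (κ : ℝ) (u v : V) :
    F.denergy κ u v = F.aForm u v + κ * F.PForm u u u v := rfl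

/-- The value `⟨J_σ(u) v, w⟩` for `m(u, u) = 1`. -/
def JForm (κ σ : ℝ) (u v w : V) : ℝ :=
  F.aForm v w + κ * (2 * F.PForm u v u w + F.PForm u u v w)
    - 2 * κ * (F.mForm u v * F.PForm u u u w) + σ * F.mForm v w

lemma J_apply_eq_JForm (κ σ : ℝ) (u v w : V) : F.J κ σ u v w = F.JForm κ σ u v w :=
  F.J_apply κ σ u v w

/-- The vector `(1 - τ) u + τ γ w` with `γ⁻¹ = m(w, u)`. -/
def dampedPoint (τ : ℝ) (u w : V) : V := (1 - τ) • u + (τ * (F.mForm w u)⁻¹) • w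

/-- The vector `z` divided by `m(z, z)^(1/2)`. -/
def normalized (z : V) : V := (√(F.mForm z z))⁻¹ • z

/-- `u'` arises from `u` by one step of the damped method. -/
def IsStep (κ σ τ : ℝ) (u u' : V) : Prop :=
  ∃ w : V, (∀ v, F.JForm κ σ u w v = F.mForm u v) ∧ F.mForm w u ≠ 0 ∧
    √(F.mForm (F.dampedPoint τ u w) (F.dampedPoint τ u w)) ≠ 0 ∧
    u' = F.normalized (F.dampedPoint τ u w)

lemma exists_JForm_equiv [CompleteSpace V] {κ σ e : ℝ} (hκ : 0 ≤ κ) {u : V}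
    (hu : F.mForm u u = 1) (he : F.energy κ u ≤ e) (hσ : 4 / 3 * e ≤ σ) :
    ∃ J : V ≃L[ℝ] (V →L[ℝ] ℝ), ∀ v w, J v w = F.JForm κ σ u v w := by
  obtain ⟨J, hJ⟩ := exists_equiv_dual (F.J_isCoercive hκ hu he hσ)
  exact ⟨J, fun v w => (hJ v w).trans (F.J_apply_eq_JForm κ σ u v w)⟩

lemma mForm_normalized {z : V} (hz : √(F.mForm z z) ≠ 0) :
    F.mForm (F.normalized z) (F.normalized z) = 1 := by
  have hz0 : 0 ≤ F.mForm z z := F.m_nonneg z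
  have h : F.mForm (F.normalized z) (F.normalized z)
      = (√(F.mForm z z))⁻¹ * ((√(F.mForm z z))⁻¹ * F.mForm z z) := by
    simp [mForm, normalized]
  rw [h]
  nth_rw 3 [← Real.mul_self_sqrt hz0]
  field_simp

lemma existsUnique_isStep [CompleteSpace V] {κ σ e S K τ : ℝ} (hκ : 0 ≤ κ) {u : V}
    (hu : F.mForm u u = 1) (he : F.energy κ u ≤ e) (hσ : 4 / 3 * e ≤ σ)
    (hS : F.DensityBound S) (hK : κ * S ^ 2 * (4 * e) ≤ K) (hτ : 0 < τ)
    (hτK : τ * (2 * (1 + K)) ≤ 1) : ∃! u' : V, F.IsStep κ σ τ u u' := by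
  obtain ⟨J, hJ⟩ := F.exists_JForm_equiv hκ hu he hσ
  obtain ⟨w, hw⟩ := J.surjective (F.m u)
  have hw' (v : V) : F.JForm κ σ u w v = F.mForm u v := by rw [← hJ, hw]; rfl
  obtain ⟨h1, h2, -⟩ := F.step_spec hκ hu he hσ hS hK hτ hτK
    (fun v => (F.J_apply_eq_JForm κ σ u w v).trans (hw' v))
  refine ⟨F.normalized (F.dampedPoint τ u w), ⟨w, hw', h1.ne', ?_, rfl⟩, ?_⟩
  · exact (Real.sqrt_pos.2 (zero_lt_one.trans_le h2)).ne'
  · rintro u' ⟨w', hw1, -, -, rfl⟩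
    have : w' = w := J.injective (ContinuousLinearMap.ext fun v => by rw [hJ, hJ, hw1, hw'])
    rw [this]

lemma IsStep.spec {F : EnergyForms V G} {κ σ e S K τ : ℝ} (hκ : 0 ≤ κ) {u u' : V}
    (hu : F.mForm u u = 1) (he : F.energy κ u ≤ e) (hσ : 4 / 3 * e ≤ σ)
    (hS : F.DensityBound S) (hK : κ * S ^ 2 * (4 * e) ≤ K) (hτ : 0 < τ)
    (hτK : τ * (2 * (1 + K)) ≤ 1) (h : F.IsStep κ σ τ u u') :
    F.mForm u' u' = 1 ∧ F.energy κ u' ≤ F.energy κ u ∧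
      ((¬ ∃ eig : ℝ, ∀ v, F.denergy κ u v = eig * F.mForm u v) →
        F.energy κ u' < F.energy κ u) := by
  obtain ⟨w, hw, -, h3, rfl⟩ := h
  obtain ⟨-, h2, h4⟩ := F.step_spec hκ hu he hσ hS hK hτ hτK
    (fun v => (F.J_apply_eq_JForm κ σ u w v).trans (hw v))
  exact ⟨F.mForm_normalized h3,
    h4 _ (by positivity) (inv_le_one_of_one_le₀ (Real.one_le_sqrt.2 h2))⟩

lemma mul_PForm_le_energy (κ : ℝ) (u : V) : κ * F.PForm u u u u ≤ 4 * F.energy κ u := by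
  rw [PForm, real_inner_self_eq_norm_sq]
  exact F.mul_norm_sq_le_energy u

/-- The forms `a(u, v) = ⟪X u, X v⟫ + ⟪M u, Y v⟫` and `m(u, v) = ⟪Y u, Y v⟫`. -/
def ofMaps {K L : Type*} [NormedAddCommGroup K] [InnerProductSpace ℝ K] [NormedAddCommGroup L]
    [InnerProductSpace ℝ L] (X : V →L[ℝ] K) (M Y : V →L[ℝ] L) (Q : V →L[ℝ] V →L[ℝ] G)
    (hM : ∀ u v, ⟪M u, Y v⟫ = ⟪M v, Y u⟫) (hQ : ∀ u v, Q u v = Q v u)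
    (hc : ∃ c, 0 < c ∧ ∀ v, c * ‖v‖ ^ 2 ≤ ⟪X v, X v⟫ + ⟪M v, Y v⟫)
    (hQ' : ∀ u v, ‖Q u v‖ ^ 2 ≤ ⟪Q u u, Q v v⟫) : EnergyForms V G where
  a := (innerL K).bilinearComp X X + (innerL L).bilinearComp M Y
  m := (innerL L).bilinearComp Y Y
  P := Q
  a_comm u v := congrArg₂ (· + ·) (real_inner_comm _ _) (hM u v)
  m_comm _ _ := real_inner_comm _ _
  P_comm := hQ
  m_nonneg _ := real_inner_self_nonneg
  a_coercive := hc
  norm_P_sq_le := hQ'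

section OfMaps

variable {K L : Type*} [NormedAddCommGroup K] [InnerProductSpace ℝ K] [NormedAddCommGroup L]
    [InnerProductSpace ℝ L] (X : V →L[ℝ] K) (M Y : V →L[ℝ] L) (Q : V →L[ℝ] V →L[ℝ] G)
    (hM : ∀ u v, ⟪M u, Y v⟫ = ⟪M v, Y u⟫) (hQ : ∀ u v, Q u v = Q v u)
    (hc : ∃ c, 0 < c ∧ ∀ v, c * ‖v‖ ^ 2 ≤ ⟪X v, X v⟫ + ⟪M v, Y v⟫)
    (hQ' : ∀ u v, ‖Q u v‖ ^ 2 ≤ ⟪Q u u, Q v v⟫)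

lemma ofMaps_densityBound {B c : ℝ} (hB : ∀ v, ‖Q v v‖ ≤ B * ‖v‖ ^ 2) (hB0 : 0 ≤ B) (hc0 : 0 < c)
    (h : ∀ v, c * ‖v‖ ^ 2 ≤ ⟪X v, X v⟫ + ⟪M v, Y v⟫) :
    (ofMaps X M Y Q hM hQ hc hQ').DensityBound (B / c) := by
  intro v
  calc ‖Q v v‖ ≤ B * ‖v‖ ^ 2 := hB v
    _ = B / c * (c * ‖v‖ ^ 2) := by field_simp
    _ ≤ _ := mul_le_mul_of_nonneg_left (h v) (by positivity)

end OfMaps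

lemma exists_norm_apply_self_le (Q : V →L[ℝ] V →L[ℝ] G) :
    ∃ B, 0 ≤ B ∧ ∀ v, ‖Q v v‖ ≤ B * ‖v‖ ^ 2 :=
  ⟨‖Q‖, norm_nonneg Q, fun v => by rw [sq, ← mul_assoc]; exact Q.le_opNorm₂ v v⟩

/-- A sequence produced by steps that exist uniquely as long as an invariant holds. -/
lemma existsUnique_seq {α : Type*} {I : α → Prop} {R : ℕ → α → α → Prop} {x₀ : α} (h₀ : I x₀)
    (hR : ∀ n x, I x → ∃! y, R n x y) (hI : ∀ n x y, I x → R n x y → I y) :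
    ∃! x : ℕ → α, x 0 = x₀ ∧ ∀ n, R n (x n) (x (n + 1)) := by
  choose f hf hf' using hR
  let g : ℕ → {x // I x} := fun n =>
    Nat.rec ⟨x₀, h₀⟩ (fun n x => ⟨f n x.1 x.2, hI n _ _ x.2 (hf n x.1 x.2)⟩) n
  refine ⟨fun n => (g n).1, ⟨rfl, fun n => hf n (g n).1 (g n).2⟩, ?_⟩
  rintro y ⟨hy0, hy⟩
  funext n
  induction n with
  | zero => exact hy0
  | succ n ih =>
    have h := hy n
    rw [ih] at h
    exact hf' n (g n).1 (g n).2 _ h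

end EnergyForms

/-! ### Sobolev and Poincaré inequalities on H¹₀(D) -/

instance instHolderTripleFourFourTwo : ENNReal.HolderTriple 4 4 2 where
  inv_add_inv_eq_inv := by
    rw [show (4 : ℝ≥0∞) = 2 * 2 by norm_num,
      ENNReal.mul_inv (Or.inl (by norm_num)) (Or.inl (by norm_num)), ← mul_add,
      ENNReal.inv_two_add_inv_two, mul_one]

instance instFactOneLeFour : Fact ((1 : ℝ≥0∞) ≤ 4) := ⟨by norm_num⟩

section Sobolev

variable {d : ℕ} {D : Set (Pt d)}

lemma enorm_fderiv_le_enorm_classicalGrad (φ : Pt d → ℂ) (x : Pt d) :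
    ‖fderiv ℝ φ x‖ₑ ≤ ‖classicalGrad φ x‖ₑ := by
  rw [enorm_le_iff_norm_le]
  refine ContinuousLinearMap.opNorm_le_bound _ (norm_nonneg _) fun y => ?_
  have hy : y = ∑ i, y i • EuclideanSpace.single i (1 : ℝ) := by
    ext j
    simp [Pi.single_apply]
  calc ‖fderiv ℝ φ x y‖ = ‖∑ i, y i • classicalGrad φ x i‖ := by
        conv_lhs => rw [hy]
        simp [map_sum, classicalGrad]
    _ ≤ ∑ i, ‖y i‖ * ‖classicalGrad φ x i‖ := by
        refine (norm_sum_le _ _).trans (le_of_eq ?_)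
        simp
    _ ≤ √(∑ i, ‖y i‖ ^ 2) * √(∑ i, ‖classicalGrad φ x i‖ ^ 2) :=
        Real.sum_mul_le_sqrt_mul_sqrt _ _ _
    _ = ‖classicalGrad φ x‖ * ‖y‖ := by
        rw [EuclideanSpace.norm_eq, EuclideanSpace.norm_eq, mul_comm]

lemma measure_univ_restrict_ne_top (hDb : Bornology.IsBounded D) :
    (volume.restrict D) Set.univ ≠ ⊤ := by
  rw [Measure.restrict_apply_univ]
  exact hDb.measure_lt_top.ne

/-- The Sobolev inequality `‖φ‖_{L⁴(D)} ≤ C ‖∇φ‖_{L²(D)}` for test functions. -/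
lemma exists_sobolev_testFunctions (hd : d = 2 ∨ d = 3) (hDb : Bornology.IsBounded D) :
    ∃ C : ℝ≥0, ∀ φ ∈ testFunctions D,
      eLpNorm φ 4 (volume.restrict D) ≤ C * eLpNorm (classicalGrad φ) 2 (volume.restrict D) := by
  -- Gagliardo-Nirenberg-Sobolev needs p < d and 1/p - 1/d ≤ 1/4. Any p in [12/7, 2) serves d = 2
  -- and d = 3 at once, and p ≤ 2 lets Hölder on the bounded set D return to L².
  set p : ℝ≥0 := 7 / 4
  set C₁ := eLpNormLESNormFDerivOfLeConst ℂ (volume : Measure (Pt d)) D p 4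
  set M := (volume.restrict D) Set.univ ^ (1 / (p : ℝ≥0∞).toReal - 1 / (2 : ℝ≥0∞).toReal)
  have hM : M ≠ ⊤ := by
    refine ENNReal.rpow_ne_top_of_nonneg ?_ (measure_univ_restrict_ne_top hDb)
    norm_num [p]
  refine ⟨C₁ * M.toNNReal, fun φ ⟨h1, h2, h3⟩ => ?_⟩
  have hsupp : φ.support ⊆ D := (subset_tsupport φ).trans h3
  have hdim : Module.finrank ℝ (Pt d) = d := by simp
  have hs := eLpNorm_le_eLpNorm_fderiv_of_le (volume : Measure (Pt d)) (F := ℂ) (u := φ) (s := D)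
    (p := p) (q := 4) (h1.of_le (by norm_num)) hsupp
    (by rw [← NNReal.coe_le_coe]; norm_num [p])
    (by rw [hdim]; rcases hd with rfl | rfl <;> rw [← NNReal.coe_lt_coe] <;> norm_num [p])
    (by rw [hdim]; rcases hd with rfl | rfl <;> norm_num [p]) hDb
  have hsupp' : (fderiv ℝ φ).support ⊆ D :=
    ((subset_tsupport _).trans (tsupport_fderiv_subset ℝ)).trans h3
  calc eLpNorm φ 4 (volume.restrict D) ≤ eLpNorm φ 4 volume := eLpNorm_restrict_le _ _ _ _
    _ ≤ C₁ * eLpNorm (fderiv ℝ φ) p volume := by simpa using hs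
    _ = C₁ * eLpNorm (fderiv ℝ φ) p (volume.restrict D) := by
        rw [← eLpNorm_norm, ← eLpNorm_norm (fderiv ℝ φ),
          eLpNorm_restrict_eq_of_support_subset (f := fun x => ‖fderiv ℝ φ x‖)]
        exact fun x hx => hsupp' fun h => hx (norm_eq_zero.2 h)
    _ ≤ C₁ * (eLpNorm (fderiv ℝ φ) 2 (volume.restrict D) * M) := by
        gcongr
        refine eLpNorm_le_eLpNorm_mul_rpow_measure_univ ?_ ?_
        · rw [show (2 : ℝ≥0∞) = ((2 : ℝ≥0) : ℝ≥0∞) by norm_num, ENNReal.coe_le_coe,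
            ← NNReal.coe_le_coe]
          norm_num [p]
        · exact (h1.continuous_fderiv (by norm_num)).aestronglyMeasurable
    _ ≤ C₁ * (eLpNorm (classicalGrad φ) 2 (volume.restrict D) * M) := by
        gcongr
        exact eLpNorm_mono_enorm fun x => enorm_fderiv_le_enorm_classicalGrad φ x
    _ = _ := by
        rw [ENNReal.coe_mul, ENNReal.coe_toNNReal hM]
        ring

lemma classicalGrad_add {φ ψ : Pt d → ℂ} (hφ : Differentiable ℝ φ) (hψ : Differentiable ℝ ψ) :
    classicalGrad (φ + ψ) = classicalGrad φ + classicalGrad ψ := by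
  ext x i
  simp [classicalGrad, fderiv_add (hφ x) (hψ x)]

lemma classicalGrad_smul {φ : Pt d → ℂ} (hφ : Differentiable ℝ φ) (c : ℝ) :
    classicalGrad (c • φ) = c • classicalGrad φ := by
  ext x i
  simp [classicalGrad, fderiv_const_smul (hφ x)]

lemma differentiable_of_mem_testFunctions {φ : Pt d → ℂ} (hφ : φ ∈ testFunctions D) :
    Differentiable ℝ φ := hφ.1.differentiable (by norm_num)

lemma exists_of_mem_testGraph {p : WithLp 2 (L2 D × L2Vec D)} (hp : p ∈ testGraph D) :
    ∃ φ ∈ testFunctions D, (p.fst : Pt d → ℂ) =ᵐ[volume.restrict D] φ ∧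
      (p.snd : Pt d → EuclideanSpace ℂ (Fin d)) =ᵐ[volume.restrict D] classicalGrad φ := by
  induction hp using Submodule.span_induction with
  | mem p h => exact h
  | zero =>
    refine ⟨0, Submodule.zero_mem _, Lp.coeFn_zero _ _ _, ?_⟩
    have : classicalGrad (0 : Pt d → ℂ) = 0 := by
      ext x i
      simp [classicalGrad]
    rw [this]
    exact Lp.coeFn_zero _ _ _
  | add p q _ _ hp hq =>
    obtain ⟨φ, hφ, h1, h2⟩ := hp
    obtain ⟨ψ, hψ, k1, k2⟩ := hq
    refine ⟨φ + ψ, Submodule.add_mem _ hφ hψ, (Lp.coeFn_add _ _).trans (h1.add k1), ?_⟩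
    rw [classicalGrad_add (differentiable_of_mem_testFunctions hφ)
      (differentiable_of_mem_testFunctions hψ)]
    exact (Lp.coeFn_add _ _).trans (h2.add k2)
  | smul c p _ hp =>
    obtain ⟨φ, hφ, h1, h2⟩ := hp
    refine ⟨c • φ, Submodule.smul_mem _ c hφ, (Lp.coeFn_smul _ _).trans (h1.const_smul c), ?_⟩
    rw [classicalGrad_smul (differentiable_of_mem_testFunctions hφ)]
    exact (Lp.coeFn_smul _ _).trans (h2.const_smul c)

/-- An L² limit is an a.e. limit along a subsequence, and Fatou's lemma makes the L⁴ norm lower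
semicontinuous there. The inequality thus passes from test functions to their closure. -/
lemma isClosed_setOf_eLpNorm_four_le (C : ℝ≥0) :
    IsClosed {p : WithLp 2 (L2 D × L2Vec D) |
      eLpNorm (p.fst : Pt d → ℂ) 4 (volume.restrict D) ≤ C * ‖p.snd‖ₑ} := by
  refine IsSeqClosed.isClosed fun p q hp hq => ?_
  have hfst : Tendsto (fun n => (p n).fst) atTop (𝓝 q.fst) :=
    ((WithLp.fstL 2 ℝ (L2 D) (L2Vec D)).continuous.tendsto q).comp hq
  have hsnd : Tendsto (fun n => C * ‖(p n).snd‖ₑ) atTop (𝓝 (C * ‖q.snd‖ₑ)) :=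
    ENNReal.Tendsto.const_mul
      ((continuous_enorm.tendsto _).comp
        (((WithLp.sndL 2 ℝ (L2 D) (L2Vec D)).continuous.tendsto q).comp hq))
      (Or.inr ENNReal.coe_ne_top)
  obtain ⟨ns, hns, hae⟩ := (tendstoInMeasure_of_tendsto_Lp hfst).exists_seq_tendsto_ae
  calc eLpNorm (q.fst : Pt d → ℂ) 4 (volume.restrict D)
      ≤ liminf (fun n => eLpNorm ((p (ns n)).fst : Pt d → ℂ) 4 (volume.restrict D)) atTop :=
        Lp.eLpNorm_lim_le_liminf_eLpNorm (fun n => Lp.aestronglyMeasurable _) _ hae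
    _ ≤ liminf (fun n => C * ‖(p (ns n)).snd‖ₑ) atTop :=
        liminf_le_liminf (Eventually.of_forall fun n => hp (ns n))
    _ = C * ‖q.snd‖ₑ := (hsnd.comp hns.tendsto_atTop).liminf_eq

/-- The Sobolev inequality `‖u‖_{L⁴(D)} ≤ C ‖∇u‖_{L²(D)}` on `H¹₀(D)`. -/
lemma exists_sobolev_H10 (hd : d = 2 ∨ d = 3) (hDb : Bornology.IsBounded D) :
    ∃ C : ℝ≥0, ∀ u : H10 D, eLpNorm (fn u) 4 (volume.restrict D) ≤ C * ‖u.1.snd‖ₑ := by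
  obtain ⟨C, hC⟩ := exists_sobolev_testFunctions hd hDb
  refine ⟨C, fun u => ?_⟩
  have hsub : ((testGraph D : Submodule ℝ (WithLp 2 (L2 D × L2Vec D))) :
      Set (WithLp 2 (L2 D × L2Vec D))) ⊆ {p |
      eLpNorm (p.fst : Pt d → ℂ) 4 (volume.restrict D) ≤ C * ‖p.snd‖ₑ} := by
    intro p hp
    obtain ⟨φ, hφ, h1, h2⟩ := exists_of_mem_testGraph hp
    rw [Set.mem_ofPred_eq, eLpNorm_congr_ae h1, Lp.enorm_def, eLpNorm_congr_ae h2]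
    exact hC φ hφ
  exact closure_minimal hsub (isClosed_setOf_eLpNorm_four_le C) u.2

end Sobolev

lemma coe_mul_enorm_eq_ofReal {E : Type*} [SeminormedAddCommGroup E] (C : ℝ≥0) (x : E) :
    C * ‖x‖ₑ = ENNReal.ofReal (C * ‖x‖) := by
  rw [ENNReal.ofReal_mul C.coe_nonneg, ofReal_norm, ENNReal.ofReal_coe_nnreal]

/-! ### The embeddings, potentials and densities as bounded maps -/

section Operators

variable {d : ℕ} {D : Set (Pt d)}

/-- The embedding `H¹₀(D) → L²(D)`. -/
def toL2 : H10 D →L[ℝ] L2 D := (WithLp.fstL 2 ℝ (L2 D) (L2Vec D)).comp (H10 D).subtypeL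

/-- The weak gradient `H¹₀(D) → L²(D; ℂ^d)`. -/
def gradL : H10 D →L[ℝ] L2Vec D := (WithLp.sndL 2 ℝ (L2 D) (L2Vec D)).comp (H10 D).subtypeL

lemma toL2_apply (u : H10 D) : toL2 u = u.1.fst := rfl

lemma gradL_apply (u : H10 D) : gradL u = u.1.snd := rfl

lemma norm_sq_H10 (u : H10 D) : ‖u‖ ^ 2 = ‖toL2 u‖ ^ 2 + ‖gradL u‖ ^ 2 :=
  WithLp.prod_norm_sq_eq_of_L2 u.1

lemma norm_gradL_le (u : H10 D) : ‖gradL u‖ ≤ ‖u‖ := by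
  refine le_of_sq_le_sq ?_ (norm_nonneg _)
  rw [norm_sq_H10 u]
  linarith [sq_nonneg ‖toL2 u‖]

/-- The Sobolev embedding of `H¹₀(D)` into `L⁴(D)`. -/
lemma exists_toL4 (hd : d = 2 ∨ d = 3) (hDb : Bornology.IsBounded D) :
    ∃ T : H10 D →L[ℝ] Lp ℂ 4 (volume.restrict D),
      ∀ u, (T u : Pt d → ℂ) =ᵐ[volume.restrict D] fn u := by
  obtain ⟨C, hC⟩ := exists_sobolev_H10 hd hDb
  have hmem (u : H10 D) : MemLp (fn u) 4 (volume.restrict D) :=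
    ⟨Lp.aestronglyMeasurable u.1.fst,
      (hC u).trans_lt (ENNReal.mul_lt_top ENNReal.coe_lt_top enorm_lt_top)⟩
  have hle (u : H10 D) : ‖(hmem u).toLp‖ ≤ C * ‖gradL u‖ := by
    rw [Lp.norm_toLp, gradL_apply]
    refine ENNReal.toReal_le_of_le_ofReal (mul_nonneg C.coe_nonneg (norm_nonneg _)) ?_
    rw [← coe_mul_enorm_eq_ofReal]
    exact hC u
  have hadd (u v : H10 D) : (hmem (u + v)).toLp = (hmem u).toLp + (hmem v).toLp :=
    (MemLp.toLp_congr (hmem (u + v)) ((hmem u).add (hmem v))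
      (Lp.coeFn_add u.1.fst v.1.fst)).trans (MemLp.toLp_add (hmem u) (hmem v))
  have hsmul (c : ℝ) (u : H10 D) : (hmem (c • u)).toLp = c • (hmem u).toLp :=
    (MemLp.toLp_congr (hmem (c • u)) ((hmem u).const_smul c)
      (Lp.coeFn_smul c u.1.fst)).trans (MemLp.toLp_const_smul c (hmem u))
  let T : H10 D →ₗ[ℝ] Lp ℂ 4 (volume.restrict D) :=
    { toFun := fun u => (hmem u).toLp
      map_add' := hadd
      map_smul' := hsmul }
  have hT (u : H10 D) : ‖T u‖ ≤ C * ‖u‖ :=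
    (hle u).trans (mul_le_mul_of_nonneg_left (norm_gradL_le u) C.coe_nonneg)
  exact ⟨T.mkContinuous C hT, fun u => (hmem u).coeFn_toLp⟩

/-- The Poincaré inequality on `H¹₀(D)`. -/
lemma exists_poincare (hd : d = 2 ∨ d = 3) (hDb : Bornology.IsBounded D) :
    ∃ C : ℝ, ∀ u : H10 D, ‖toL2 u‖ ≤ C * ‖gradL u‖ := by
  obtain ⟨C, hC⟩ := exists_sobolev_H10 hd hDb
  -- D has finite measure, so Hölder bounds L² by L⁴ and Poincaré follows from Sobolev.
  obtain ⟨M, hM, hle⟩ : ∃ M : ℝ≥0∞, M ≠ ⊤ ∧ ∀ f : Pt d → ℂ,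
      AEStronglyMeasurable f (volume.restrict D) →
      eLpNorm f 2 (volume.restrict D) ≤ eLpNorm f 4 (volume.restrict D) * M := by
    refine ⟨_, ENNReal.rpow_ne_top_of_nonneg ?_ (measure_univ_restrict_ne_top hDb),
      fun f hf => eLpNorm_le_eLpNorm_mul_rpow_measure_univ (by norm_num) hf⟩
    norm_num
  have hle' (u : H10 D) : eLpNorm (u.1.fst : Pt d → ℂ) 2 (volume.restrict D)
      ≤ (C * M.toNNReal : ℝ≥0) * ‖u.1.snd‖ₑ := by
    rw [ENNReal.coe_mul, ENNReal.coe_toNNReal hM, mul_right_comm]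
    exact (hle _ (Lp.aestronglyMeasurable u.1.fst)).trans (mul_left_mono (hC u))
  refine ⟨(C * M.toNNReal : ℝ≥0), fun u => ?_⟩
  rw [toL2_apply, gradL_apply, Lp.norm_def]
  refine ENNReal.toReal_le_of_le_ofReal (mul_nonneg (NNReal.coe_nonneg _) (norm_nonneg _)) ?_
  rw [← coe_mul_enorm_eq_ofReal]
  exact hle' u

instance instCompleteSpaceH10 : CompleteSpace (H10 D) := by
  have : CompleteSpace (L2 D) := inferInstance
  have : CompleteSpace (L2Vec D) := inferInstance
  have : CompleteSpace (WithLp 2 (L2 D × L2Vec D)) := inferInstance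
  exact (Submodule.isClosed_topologicalClosure _).completeSpace_coe

lemma coeFn_toL2 (u : H10 D) : (toL2 u : Pt d → ℂ) = fn u := rfl

lemma coeFn_gradL (u : H10 D) :
    (gradL u : Pt d → EuclideanSpace ℂ (Fin d)) = wgrad u := rfl

attribute [irreducible] toL2 gradL

end Operators

lemma re_inner_L2 {α E : Type*} {mα : MeasurableSpace α} {μ : Measure α} [NormedAddCommGroup E]
    [InnerProductSpace ℂ E] [InnerProductSpace ℝ E]
    (h : ∀ x y : E, (inner ℂ x y).re = ⟪x, y⟫) (f g : Lp E 2 μ) :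
    (inner ℂ f g).re = ⟪f, g⟫ := by
  rw [L2.inner_def, L2.inner_def]
  have := integral_re (L2.integrable_inner (𝕜 := ℂ) f g)
  simp only [RCLike.re_eq_complex_re] at this
  rw [← this]
  simp only [h]

lemma re_inner_complex (z w : ℂ) : (inner ℂ z w).re = ⟪z, w⟫ := by
  rw [RCLike.inner_apply, Complex.inner, mul_comm]

lemma re_inner_euclideanSpace {d : ℕ} (x y : EuclideanSpace ℂ (Fin d)) :
    (inner ℂ x y).re = ⟪x, y⟫ := by
  rw [PiLp.inner_apply, PiLp.inner_apply, Complex.re_sum]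
  simp only [re_inner_complex]

section Multiplication

variable {d : ℕ} {D : Set (Pt d)}

/-- Multiplication by the bounded potential `U`. -/
def potL (U : Lp ℝ ⊤ (volume.restrict D)) : H10 D →L[ℝ] L2 D :=
  ((ContinuousLinearMap.lsmul ℝ ℝ : ℝ →L[ℝ] ℂ →L[ℝ] ℂ).holderL (volume.restrict D) ⊤ 2 2 U).comp
    toL2

/-- The density `Re (u v̄)`. -/
def densityL (T : H10 D →L[ℝ] Lp ℂ 4 (volume.restrict D)) :
    H10 D →L[ℝ] H10 D →L[ℝ] Lp ℝ 2 (volume.restrict D) :=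
  ((EnergyForms.innerL ℂ).holderL (volume.restrict D) 4 4 2).bilinearComp T T

lemma coeFn_potL {U : Pt d → ℝ} (hU : MemLp U ⊤ (volume.restrict D)) (v : H10 D) :
    (potL hU.toLp v : Pt d → ℂ) =ᵐ[volume.restrict D] fun x => (U x : ℂ) * fn v x := by
  have h1 := (ContinuousLinearMap.lsmul ℝ ℝ : ℝ →L[ℝ] ℂ →L[ℝ] ℂ).coeFn_holder (r := 2)
      hU.toLp (toL2 v)
  filter_upwards [h1, hU.coeFn_toLp] with x h1 h2
  refine h1.trans ?_
  rw [h2, coeFn_toL2]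
  exact Complex.real_smul

lemma coeFn_densityL {T : H10 D →L[ℝ] Lp ℂ 4 (volume.restrict D)}
    (hT : ∀ u, (T u : Pt d → ℂ) =ᵐ[volume.restrict D] fn u) (u v : H10 D) :
    (densityL T u v : Pt d → ℝ) =ᵐ[volume.restrict D] fun x => (fn u x * conj (fn v x)).re := by
  have h1 := (EnergyForms.innerL ℂ).coeFn_holder (r := 2) (T u) (T v)
  filter_upwards [h1, hT u, hT v] with x h1 h2 h3
  refine h1.trans ?_
  rw [h2, h3, EnergyForms.innerL_apply, Complex.inner]
  simp only [Complex.mul_re, Complex.conj_re, Complex.conj_im]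
  ring

end Multiplication

section Forms

variable {d : ℕ} [NeZero d] {D : Set (Pt d)}

lemma norm_rotField_le (x : Pt d) (hd : d = 2 ∨ d = 3) : ‖rotField x‖ ≤ ‖x‖ := by
  refine le_of_sq_le_sq ?_ (norm_nonneg _)
  rw [EuclideanSpace.norm_sq_eq, EuclideanSpace.norm_sq_eq]
  rcases hd with rfl | rfl
  · simp [rotField, Fin.sum_univ_two, add_comm]
  · simp [rotField, Fin.sum_univ_three]
    nlinarith [sq_nonneg (x 2)]

lemma continuous_rotField : Continuous (rotField : Pt d → Pt d) := by
  unfold rotField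
  refine (PiLp.continuous_toLp 2 _).comp (continuous_pi fun i => ?_)
  split_ifs <;> fun_prop

/-- The field `i (Ω / 2) R`, complexified. -/
def rotCoeff (Ω : ℝ) (x : Pt d) : EuclideanSpace ℂ (Fin d) :=
  WithLp.toLp 2 fun i => Complex.I * ((Ω / 2 : ℝ) : ℂ) * ((rotField x i : ℝ) : ℂ)

lemma norm_rotCoeff (Ω : ℝ) (x : Pt d) : ‖rotCoeff Ω x‖ = |Ω| / 2 * ‖rotField x‖ := by
  rw [← sq_eq_sq₀ (norm_nonneg _) (by positivity), mul_pow, EuclideanSpace.norm_sq_eq,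
    EuclideanSpace.norm_sq_eq, Finset.mul_sum]
  refine Finset.sum_congr rfl fun i _ => ?_
  simp [rotCoeff, mul_pow]

lemma continuous_rotCoeff (Ω : ℝ) : Continuous (rotCoeff Ω : Pt d → EuclideanSpace ℂ (Fin d)) := by
  have h := continuous_rotField (d := d)
  refine (PiLp.continuous_toLp 2 _).comp (continuous_pi fun i => ?_)
  refine continuous_const.mul (Complex.continuous_ofReal.comp ?_)
  exact (continuous_apply i).comp ((PiLp.continuous_ofLp 2 _).comp h)

lemma exists_norm_rotField_le (hd : d = 2 ∨ d = 3) (hDb : Bornology.IsBounded D) :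
    ∃ C, 0 ≤ C ∧ ∀ x ∈ D, ‖rotField x‖ ≤ C := by
  obtain ⟨C, hC, h⟩ := hDb.exists_pos_norm_le
  exact ⟨C, hC.le, fun x hx => (norm_rotField_le x hd).trans (h x hx)⟩

lemma memLp_rotCoeff (hd : d = 2 ∨ d = 3) (hDo : IsOpen D) (hDb : Bornology.IsBounded D) (Ω : ℝ) :
    MemLp (rotCoeff Ω) ⊤ (volume.restrict D) := by
  obtain ⟨C, hC, h⟩ := exists_norm_rotField_le hd hDb
  refine memLp_top_of_bound (continuous_rotCoeff Ω).aestronglyMeasurable (|Ω| / 2 * C)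
    (ae_restrict_of_forall_mem hDo.measurableSet fun x hx => ?_)
  rw [norm_rotCoeff]
  have := h x hx
  gcongr

lemma memLp_rotPot (hd : d = 2 ∨ d = 3) (hDo : IsOpen D) (hDb : Bornology.IsBounded D) (Ω : ℝ)
    {W : Pt d → ℝ} (hW : MemLp W ⊤ (volume.restrict D)) :
    MemLp (rotPot Ω W) ⊤ (volume.restrict D) := by
  obtain ⟨C, hC, h⟩ := exists_norm_rotField_le hd hDb
  refine hW.sub (memLp_top_of_bound (Continuous.aestronglyMeasurable ?_) (Ω ^ 2 * C ^ 2 / 4)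
    (ae_restrict_of_forall_mem hDo.measurableSet fun x hx => ?_))
  · exact (continuous_const.mul (continuous_rotField.norm.pow 2)).div_const 4
  · rw [Real.norm_of_nonneg (by positivity)]
    have := h x hx
    gcongr

/-- The rotational gradient as a bounded operator, with coefficient field `R`. -/
def rotGradL (R : Lp (EuclideanSpace ℂ (Fin d)) ⊤ (volume.restrict D)) : H10 D →L[ℝ] L2Vec D :=
  gradL + (((ContinuousLinearMap.lsmul ℝ ℂ :
    ℂ →L[ℝ] EuclideanSpace ℂ (Fin d) →L[ℝ] EuclideanSpace ℂ (Fin d)).holderL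
      (volume.restrict D) 2 ⊤ 2).flip R).comp toL2

lemma coeFn_rotGradL {Ω : ℝ} (hR : MemLp (rotCoeff Ω) ⊤ (volume.restrict D)) (v : H10 D) :
    (rotGradL hR.toLp v : Pt d → EuclideanSpace ℂ (Fin d)) =ᵐ[volume.restrict D] rotGrad Ω v := by
  have h1 := (ContinuousLinearMap.lsmul ℝ ℂ :
    ℂ →L[ℝ] EuclideanSpace ℂ (Fin d) →L[ℝ] EuclideanSpace ℂ (Fin d)).coeFn_holder (r := 2)
      (toL2 v) hR.toLp
  filter_upwards [Lp.coeFn_add (gradL v) ((ContinuousLinearMap.lsmul ℝ ℂ :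
    ℂ →L[ℝ] EuclideanSpace ℂ (Fin d) →L[ℝ] EuclideanSpace ℂ (Fin d)).holder 2
      (toL2 v) hR.toLp), h1, hR.coeFn_toLp] with x h1 h2 h3
  refine h1.trans ?_
  rw [Pi.add_apply, h2, h3]
  ext i
  simp only [PiLp.add_apply, ContinuousLinearMap.lsmul_apply, PiLp.smul_apply, smul_eq_mul,
    rotCoeff, rotGrad, coeFn_toL2, coeFn_gradL]
  rw [mul_comm]

end Forms

attribute [irreducible] rotGradL potL densityL

/-! ### Integrals as inner products -/

section Identification

variable {d : ℕ} {D : Set (Pt d)}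

lemma re_integral_mul_conj (p q : L2 D) :
    (∫ x in D, p x * conj (q x)).re = ⟪p, q⟫ := by
  rw [real_inner_comm, ← re_inner_L2 re_inner_complex, L2.inner_def]
  rfl

lemma inner_toL2 (u v : H10 D) : ⟪toL2 u, toL2 v⟫ = innerH u v :=
  (re_integral_mul_conj (toL2 u) (toL2 v)).symm.trans (by rw [coeFn_toL2, coeFn_toL2]; rfl)

/-- The integral of `f ḡ h k̄` exists for `f, g, h, k` in `L⁴`. -/
lemma integrable_quartic {f g h k : Pt d → ℂ} (hf : MemLp f 4 (volume.restrict D))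
    (hg : MemLp g 4 (volume.restrict D)) (hh : MemLp h 4 (volume.restrict D))
    (hk : MemLp k 4 (volume.restrict D)) :
    Integrable (fun x => f x * conj (g x) * (h x * conj (k x))) (volume.restrict D) := by
  have h1 : MemLp (fun x => f x * conj (g x)) 2 (volume.restrict D) := hg.star.mul hf
  have h2 : MemLp (fun x => h x * conj (k x)) 2 (volume.restrict D) := hk.star.mul hh
  exact h1.integrable_mul h2

lemma integrable_re_mul_re {f g h k : Pt d → ℂ} (hf : MemLp f 4 (volume.restrict D))
    (hg : MemLp g 4 (volume.restrict D)) (hh : MemLp h 4 (volume.restrict D))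
    (hk : MemLp k 4 (volume.restrict D)) :
    Integrable (fun x => (f x * conj (g x)).re * (h x * conj (k x)).re) (volume.restrict D) := by
  have h1 : MemLp (fun x => f x * conj (g x)) 2 (volume.restrict D) := hg.star.mul hf
  have h2 : MemLp (fun x => h x * conj (k x)) 2 (volume.restrict D) := hk.star.mul hh
  exact h1.re.integrable_mul h2.re

lemma re_integral_norm_sq_mul {f g h : Pt d → ℂ} (hf : MemLp f 4 (volume.restrict D))
    (hg : MemLp g 4 (volume.restrict D)) (hh : MemLp h 4 (volume.restrict D)) :
    (∫ x in D, ((‖f x‖ ^ 2 : ℝ) : ℂ) * g x * conj (h x)).re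
      = ∫ x in D, (f x * conj (f x)).re * (g x * conj (h x)).re := by
  have hint := integral_re (𝕜 := ℂ) (integrable_quartic hf hf hg hh)
  simp only [RCLike.re_eq_complex_re] at hint
  have h2 (x : Pt d) : ((‖f x‖ ^ 2 : ℝ) : ℂ) * g x * conj (h x)
      = f x * conj (f x) * (g x * conj (h x)) := by
    rw [Complex.mul_conj, Complex.normSq_eq_norm_sq, mul_assoc]
  simp only [h2]
  rw [← hint]
  refine integral_congr_ae (Eventually.of_forall fun x => ?_)
  simp only [Complex.mul_conj, Complex.re_ofReal_mul, Complex.ofReal_re]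

/-- Pointwise, f ḡ + g f̄ = 2 Re(f ḡ) is real, and the remaining g f̄ f h̄ equals |f|² g h̄. -/
lemma re_integral_linearization {f g h : Pt d → ℂ} (hf : MemLp f 4 (volume.restrict D))
    (hg : MemLp g 4 (volume.restrict D)) (hh : MemLp h 4 (volume.restrict D)) :
    (∫ x in D, (f x * conj (g x) + 2 * g x * conj (f x)) * f x * conj (h x)).re
      = 2 * (∫ x in D, (f x * conj (g x)).re * (f x * conj (h x)).re)
        + ∫ x in D, (f x * conj (f x)).re * (g x * conj (h x)).re := by
  rw [← integral_const_mul, ← integral_add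
    ((integrable_re_mul_re hf hg hf hh).const_mul 2) (integrable_re_mul_re hf hf hg hh)]
  have hint : Integrable (fun x => (f x * conj (g x) + 2 * g x * conj (f x))
          * f x * conj (h x)) (volume.restrict D) := by
    refine ((integrable_quartic hf hg hf hh).add
      ((integrable_quartic hg hf hf hh).const_mul 2)).congr (Eventually.of_forall fun x => ?_)
    simp only [Pi.add_apply]
    ring
  have h := integral_re (𝕜 := ℂ) hint
  simp only [RCLike.re_eq_complex_re] at h
  rw [← h]
  refine integral_congr_ae (Eventually.of_forall fun x => ?_)
  simp only [Complex.mul_re, Complex.add_re, Complex.add_im, Complex.mul_im, Complex.conj_re,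
    Complex.conj_im, Complex.re_ofNat, Complex.im_ofNat]
  ring

lemma integral_re_sq_le {f g : Pt d → ℂ} (hf : MemLp f 4 (volume.restrict D))
    (hg : MemLp g 4 (volume.restrict D)) :
    ∫ x in D, (f x * conj (g x)).re * (f x * conj (g x)).re
      ≤ ∫ x in D, (f x * conj (f x)).re * (g x * conj (g x)).re := by
  refine integral_mono (integrable_re_mul_re hf hg hf hg) (integrable_re_mul_re hf hf hg hg)
    fun x => ?_
  simp only [Complex.mul_re, Complex.conj_re, Complex.conj_im]
  nlinarith [sq_nonneg ((f x).re * (g x).im - (f x).im * (g x).re)]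

variable {T : H10 D →L[ℝ] Lp ℂ 4 (volume.restrict D)}

lemma inner_densityL (hT : ∀ u, (T u : Pt d → ℂ) =ᵐ[volume.restrict D] fn u) (u v w z : H10 D) :
    ⟪densityL T u v, densityL T w z⟫
      = ∫ x in D, (fn u x * conj (fn v x)).re * (fn w x * conj (fn z x)).re := by
  rw [L2.inner_def]
  refine integral_congr_ae ?_
  filter_upwards [coeFn_densityL hT u v, coeFn_densityL hT w z] with x h1 h2
  rw [h1, h2]
  exact mul_comm _ _

lemma memLp_fn (hT : ∀ u, (T u : Pt d → ℂ) =ᵐ[volume.restrict D] fn u) (u : H10 D) :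
    MemLp (fn u) 4 (volume.restrict D) := (Lp.memLp (T u)).ae_eq (hT u)

lemma norm_densityL_sq_le (hT : ∀ u, (T u : Pt d → ℂ) =ᵐ[volume.restrict D] fn u) (u v : H10 D) :
    ‖densityL T u v‖ ^ 2 ≤ ⟪densityL T u u, densityL T v v⟫ :=
  ((real_inner_self_eq_norm_sq (densityL T u v)).symm.trans
    (inner_densityL hT u v u v)).trans_le
    ((integral_re_sq_le (memLp_fn hT u) (memLp_fn hT v)).trans_eq (inner_densityL hT u u v v).symm)

lemma densityL_comm (hT : ∀ u, (T u : Pt d → ℂ) =ᵐ[volume.restrict D] fn u) (u v : H10 D) :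
    densityL T u v = densityL T v u := by
  refine Lp.ext ?_
  filter_upwards [coeFn_densityL hT u v, coeFn_densityL hT v u] with x h1 h2
  rw [h1, h2]
  simp only [Complex.mul_re, Complex.conj_re, Complex.conj_im]
  ring

lemma re_integral_sum_mul_conj_add (X Y : L2Vec D) (p q : L2 D) :
    (∫ x in D, ((∑ i, X x i * conj (Y x i)) + p x * conj (q x))).re = ⟪X, Y⟫ + ⟪p, q⟫ := by
  have h : ∫ x in D, ((∑ i, X x i * conj (Y x i)) + p x * conj (q x))
      = inner ℂ Y X + inner ℂ q p := by
    rw [L2.inner_def, L2.inner_def, ← integral_add (L2.integrable_inner _ _)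
      (L2.integrable_inner _ _)]
    refine integral_congr_ae (Eventually.of_forall fun x => ?_)
    simp only [PiLp.inner_apply]
    rfl
  rw [h, Complex.add_re, re_inner_L2 re_inner_euclideanSpace, re_inner_L2 re_inner_complex,
    real_inner_comm, real_inner_comm p]

lemma real_inner_ofReal_mul_comm (c : ℝ) (z w : ℂ) : ⟪(c : ℂ) * z, w⟫ = ⟪(c : ℂ) * w, z⟫ := by
  rw [← Complex.real_smul, ← Complex.real_smul, real_inner_smul_left, real_inner_smul_left,
    real_inner_comm]

lemma potL_comm {U : Pt d → ℝ} (hU : MemLp U ⊤ (volume.restrict D)) (v w : H10 D) :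
    ⟪potL hU.toLp v, toL2 w⟫ = ⟪potL hU.toLp w, toL2 v⟫ := by
  refine (L2.inner_def _ _).trans ((integral_congr_ae ?_).trans (L2.inner_def _ _).symm)
  filter_upwards [coeFn_potL hU v, coeFn_potL hU w] with x h1 h2
  rw [h1, h2, coeFn_toL2, coeFn_toL2]
  exact real_inner_ofReal_mul_comm _ _ _

lemma inner_potL_self {U : Pt d → ℝ} (hU : MemLp U ⊤ (volume.restrict D)) (v : H10 D) :
    (fun x => ⟪(potL hU.toLp v : Pt d → ℂ) x, fn v x⟫) =ᵐ[volume.restrict D]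
      fun x => U x * ‖fn v x‖ ^ 2 := by
  filter_upwards [coeFn_potL hU v] with x h1
  rw [h1, ← Complex.real_smul, real_inner_smul_left]
  exact congrArg _ (real_inner_self_eq_norm_sq _)

end Identification

/-! ### Coercivity of the quadratic part -/

section Energy

variable {d : ℕ} [NeZero d] {D : Set (Pt d)} {Ω : ℝ} {W : Pt d → ℝ}

lemma re_linForm (hR : MemLp (rotCoeff Ω) ⊤ (volume.restrict D))
    (hU : MemLp (rotPot Ω W) ⊤ (volume.restrict D)) (v w : H10 D) :
    (linForm Ω W v w).re = ⟪rotGradL hR.toLp v, rotGradL hR.toLp w⟫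
      + ⟪potL hU.toLp v, toL2 w⟫ := by
  refine (congrArg Complex.re (integral_congr_ae ?_)).trans
    (re_integral_sum_mul_conj_add (rotGradL hR.toLp v) (rotGradL hR.toLp w) (potL hU.toLp v)
      (toL2 w))
  filter_upwards [coeFn_rotGradL hR v, coeFn_rotGradL hR w, coeFn_potL hU v] with x h1 h2 h3
  rw [h1, h2, h3, coeFn_toL2]

lemma rotGrad_eq (v : H10 D) (x : Pt d) :
    rotGrad Ω v x = wgrad v x + fn v x • rotCoeff Ω x := by
  ext i
  simp only [rotGrad, rotCoeff, PiLp.add_apply, PiLp.smul_apply, smul_eq_mul]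
  ring

/-- Put g = |∇v| and y = |Ω||R||v|. The reverse triangle inequality and W_R ≥ (3/4) Ω²|R|² bound the
right side below by (g - y/2)² + (3/4) y² = (3/4) g² + (g/2 - y)². The constant is free of Ω and W.
-/
lemma three_fourths_norm_sq_le (v : H10 D) {x : Pt d} (hx : Ω ^ 2 * ‖rotField x‖ ^ 2 ≤ W x) :
    3 / 4 * ‖wgrad v x‖ ^ 2 ≤ ‖rotGrad Ω v x‖ ^ 2 + rotPot Ω W x * ‖fn v x‖ ^ 2 := by
  have h1 : |‖wgrad v x‖ - ‖fn v x • rotCoeff Ω x‖| ≤ ‖rotGrad Ω v x‖ := by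
    rw [rotGrad_eq]
    have := abs_norm_sub_norm_le (wgrad v x) (-(fn v x • rotCoeff Ω x))
    rwa [norm_neg, sub_neg_eq_add] at this
  rw [norm_smul, norm_rotCoeff] at h1
  have h2 := pow_le_pow_left₀ (abs_nonneg _) h1 2
  rw [sq_abs] at h2
  have h3 : 3 / 4 * (Ω ^ 2 * ‖rotField x‖ ^ 2) ≤ rotPot Ω W x := by
    unfold rotPot
    linarith
  have h4 := mul_le_mul_of_nonneg_right h3 (sq_nonneg ‖fn v x‖)
  rw [← sq_abs Ω] at h4
  nlinarith [sq_nonneg (‖wgrad v x‖ - 2 * (‖fn v x‖ * (|Ω| * ‖rotField x‖)))]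

lemma inner_rotGradL_self (hR : MemLp (rotCoeff Ω) ⊤ (volume.restrict D)) (v : H10 D) :
    (fun x => ⟪(rotGradL hR.toLp v : Pt d → EuclideanSpace ℂ (Fin d)) x,
      (rotGradL hR.toLp v : Pt d → EuclideanSpace ℂ (Fin d)) x⟫) =ᵐ[volume.restrict D]
      fun x => ‖rotGrad Ω v x‖ ^ 2 := by
  filter_upwards [coeFn_rotGradL hR v] with x h1
  rw [h1, real_inner_self_eq_norm_sq]

lemma integrable_rotGrad_sq (hR : MemLp (rotCoeff Ω) ⊤ (volume.restrict D)) (v : H10 D) :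
    Integrable (fun x => ‖rotGrad Ω v x‖ ^ 2) (volume.restrict D) :=
  (L2.integrable_inner (𝕜 := ℝ) (rotGradL hR.toLp v) (rotGradL hR.toLp v)).congr
    (inner_rotGradL_self hR v)

lemma integrable_rotPot_mul_sq (hU : MemLp (rotPot Ω W) ⊤ (volume.restrict D)) (v : H10 D) :
    Integrable (fun x => rotPot Ω W x * ‖fn v x‖ ^ 2) (volume.restrict D) :=
  (L2.integrable_inner (𝕜 := ℝ) (potL hU.toLp v) (toL2 v)).congr
    ((coeFn_toL2 v).symm ▸ inner_potL_self hU v)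

lemma inner_rotGradL_add_inner_potL (hR : MemLp (rotCoeff Ω) ⊤ (volume.restrict D))
    (hU : MemLp (rotPot Ω W) ⊤ (volume.restrict D)) (v : H10 D) :
    ⟪rotGradL hR.toLp v, rotGradL hR.toLp v⟫ + ⟪potL hU.toLp v, toL2 v⟫
      = ∫ x in D, (‖rotGrad Ω v x‖ ^ 2 + rotPot Ω W x * ‖fn v x‖ ^ 2) := by
  rw [integral_add (integrable_rotGrad_sq hR v) (integrable_rotPot_mul_sq hU v)]
  refine congrArg₂ (· + ·) ?_ ?_
  · rw [L2.inner_def]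
    exact integral_congr_ae (inner_rotGradL_self hR v)
  · rw [L2.inner_def, coeFn_toL2]
    exact integral_congr_ae (inner_potL_self hU v)

lemma three_fourths_gradL_sq_le (hR : MemLp (rotCoeff Ω) ⊤ (volume.restrict D))
    (hU : MemLp (rotPot Ω W) ⊤ (volume.restrict D))
    (hW : ∀ᵐ x ∂(volume.restrict D), Ω ^ 2 * ‖rotField x‖ ^ 2 ≤ W x) (v : H10 D) :
    3 / 4 * ‖gradL v‖ ^ 2 ≤ ⟪rotGradL hR.toLp v, rotGradL hR.toLp v⟫
      + ⟪potL hU.toLp v, toL2 v⟫ := by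
  rw [inner_rotGradL_add_inner_potL hR hU v, ← real_inner_self_eq_norm_sq, L2.inner_def,
    ← integral_const_mul]
  refine integral_mono_ae ((L2.integrable_inner (𝕜 := ℝ) (gradL v) (gradL v)).const_mul _)
    ((integrable_rotGrad_sq hR v).add (integrable_rotPot_mul_sq hU v)) ?_
  filter_upwards [hW] with x hx
  simp only [real_inner_self_eq_norm_sq, coeFn_gradL]
  exact three_fourths_norm_sq_le v hx

lemma half_mul_integral_add {α : Type*} {mα : MeasurableSpace α} {μ : Measure α} {f g : α → ℝ}
    (hf : Integrable f μ) (hg : Integrable g μ) (κ : ℝ) :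
    1 / 2 * ∫ x, (f x + κ / 2 * g x) ∂μ = 1 / 2 * ∫ x, f x ∂μ + κ / 4 * ∫ x, g x ∂μ := by
  rw [integral_add hf (hg.const_mul _), integral_const_mul]
  ring

lemma norm_pow_four (z : ℂ) : ‖z‖ ^ 4 = (z * conj z).re * (z * conj z).re := by
  rw [Complex.mul_conj, Complex.ofReal_re, Complex.normSq_eq_norm_sq]
  ring

lemma energy_eq_integral (κ : ℝ) (u : H10 D) :
    energy κ Ω W u = 1 / 2 * ∫ x in D, (‖rotGrad Ω u x‖ ^ 2 + rotPot Ω W x * ‖fn u x‖ ^ 2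
      + κ / 2 * ((fn u x * conj (fn u x)).re * (fn u x * conj (fn u x)).re)) := by
  unfold energy
  simp only [norm_pow_four]

end Energy

/-! ### The Gross-Pitaevskii problem as an instance of the abstract forms -/

section Representation

variable {d : ℕ} {D : Set (Pt d)}

lemma exists_gradL_coercive (hd : d = 2 ∨ d = 3)
    (hDb : Bornology.IsBounded D) :
    ∃ c, 0 < c ∧ ∀ u : H10 D, c * ‖u‖ ^ 2 ≤ 3 / 4 * ‖gradL u‖ ^ 2 := by
  obtain ⟨C, hC⟩ := exists_poincare hd hDb
  refine ⟨3 / 4 * (C ^ 2 + 1)⁻¹, by positivity, fun u => ?_⟩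
  rw [mul_assoc]
  refine mul_le_mul_of_nonneg_left ?_ (by norm_num)
  rw [inv_mul_le_iff₀ (by positivity), norm_sq_H10 u]
  have := pow_le_pow_left₀ (norm_nonneg _) (hC u) 2
  rw [mul_pow] at this
  linarith

/-- Ensures that the L⁴ norm of u₀ is positive, so that the energy of u₀ bounds κ. -/
lemma densityL_self_ne_zero {T : H10 D →L[ℝ] Lp ℂ 4 (volume.restrict D)}
    (hT : ∀ u, (T u : Pt d → ℂ) =ᵐ[volume.restrict D] fn u) {u : H10 D}
    (hu : normH u ≠ 0) : densityL T u u ≠ 0 := by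
  intro h
  apply hu
  have h1 := coeFn_densityL hT u u
  rw [h] at h1
  refine (norm_eq_zero (a := (u.1.fst : L2 D))).2 (Lp.ext ?_)
  filter_upwards [h1, Lp.coeFn_zero ℝ 2 (volume.restrict D),
    Lp.coeFn_zero ℂ 2 (volume.restrict D)] with x h1 h2 h3
  rw [h2] at h1
  rw [h3]
  simp only [Pi.zero_apply, Complex.mul_conj, Complex.ofReal_re] at h1
  exact Complex.normSq_eq_zero.1 h1.symm

variable [NeZero d] {Ω : ℝ} {W : Pt d → ℝ}

/-- `F` consists of the Gross-Pitaevskii forms with parameters `Ω` and `W`. -/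
structure Represents (F : EnergyForms (H10 D) (Lp ℝ 2 (volume.restrict D))) (Ω : ℝ)
    (W : Pt d → ℝ) : Prop where
  innerH_eq : ∀ u v, innerH u v = F.mForm u v
  re_linForm_eq : ∀ v w, (linForm Ω W v w).re = F.aForm v w
  memLp_fn : ∀ u : H10 D, MemLp (fn u) 4 (volume.restrict D)
  PForm_eq : ∀ u v w z, F.PForm u v w z
    = ∫ x in D, (fn u x * conj (fn v x)).re * (fn w x * conj (fn z x)).re
  integrable : ∀ v : H10 D, Integrable
    (fun x => ‖rotGrad Ω v x‖ ^ 2 + rotPot Ω W x * ‖fn v x‖ ^ 2) (volume.restrict D)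
  aForm_self_eq : ∀ v, F.aForm v v
    = ∫ x in D, (‖rotGrad Ω v x‖ ^ 2 + rotPot Ω W x * ‖fn v x‖ ^ 2)

lemma exists_represents {T : H10 D →L[ℝ] Lp ℂ 4 (volume.restrict D)}
    (hT : ∀ u, (T u : Pt d → ℂ) =ᵐ[volume.restrict D] fn u) {c B : ℝ} (hc : 0 < c)
    (hcoer : ∀ u : H10 D, c * ‖u‖ ^ 2 ≤ 3 / 4 * ‖gradL u‖ ^ 2) (hB0 : 0 ≤ B)
    (hB : ∀ v, ‖densityL T v v‖ ≤ B * ‖v‖ ^ 2)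
    (hR : MemLp (rotCoeff Ω) ⊤ (volume.restrict D))
    (hU : MemLp (rotPot Ω W) ⊤ (volume.restrict D))
    (hW : ∀ᵐ x ∂(volume.restrict D), Ω ^ 2 * ‖rotField x‖ ^ 2 ≤ W x) :
    ∃ F : EnergyForms (H10 D) (Lp ℝ 2 (volume.restrict D)), Represents F Ω W ∧
      F.DensityBound (B / c) := by
  have h (v : H10 D) := (hcoer v).trans (three_fourths_gradL_sq_le hR hU hW v)
  exact ⟨.ofMaps (rotGradL hR.toLp) (potL hU.toLp) toL2 (densityL T) (potL_comm hU)
    (densityL_comm hT) ⟨c, hc, h⟩ (norm_densityL_sq_le hT),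
    ⟨fun u v => (inner_toL2 u v).symm, re_linForm hR hU, GPE.memLp_fn hT, inner_densityL hT,
      fun v => (integrable_rotGrad_sq hR v).add (integrable_rotPot_mul_sq hU v),
      inner_rotGradL_add_inner_potL hR hU⟩,
    EnergyForms.ofMaps_densityBound _ _ _ _ _ _ _ _ hB hB0 hc h⟩

/-- The forms exist, with a bound on the density that depends on the domain only. -/
lemma exists_represents_of_domain (hd : d = 2 ∨ d = 3) (hDo : IsOpen D)
    (hDb : Bornology.IsBounded D) {u₀ : H10 D} (hu₀ : normH u₀ ≠ 0) :
    ∃ S p : ℝ, 0 < p ∧ ∀ (Ω : ℝ) (W : Pt d → ℝ), MemLp W ⊤ (volume.restrict D) →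
      (∀ᵐ x ∂(volume.restrict D), Ω ^ 2 * ‖rotField x‖ ^ 2 ≤ W x) →
      ∃ F : EnergyForms (H10 D) (Lp ℝ 2 (volume.restrict D)), Represents F Ω W ∧
        F.DensityBound S ∧ F.PForm u₀ u₀ u₀ u₀ = p := by
  obtain ⟨T, hT⟩ := exists_toL4 hd hDb
  obtain ⟨c, hc, hcoer⟩ := exists_gradL_coercive hd hDb
  obtain ⟨B, hB0, hB⟩ := EnergyForms.exists_norm_apply_self_le (densityL T)
  -- S = B / c and p = ∫ |u₀|⁴ are fixed before Ω and W enter.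
  refine ⟨B / c, _, (real_inner_self_pos.2 (densityL_self_ne_zero hT hu₀)).trans_eq
    (inner_densityL hT u₀ u₀ u₀ u₀), fun Ω W hWm hW => ?_⟩
  obtain ⟨F, hF, hS⟩ := exists_represents hT hc hcoer hB0 hB (memLp_rotCoeff hd hDo hDb Ω)
    (memLp_rotPot hd hDo hDb Ω hWm) hW
  exact ⟨F, hF, hS, hF.PForm_eq u₀ u₀ u₀ u₀⟩

lemma linearization_congr {l a i p i' p' m m' n n' : ℝ} (h₁ : l = a) (h₂ : i = p) (h₃ : i' = p')
    (h₄ : m = m') (h₅ : n = n') (κ σ : ℝ) :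
    l + κ * i - 2 * κ * (m * i') + σ * n = a + κ * p - 2 * κ * (m' * p') + σ * n' := by
  rw [h₁, h₂, h₃, h₄, h₅]

lemma formJ_of_normH_eq_one (κ σ : ℝ) {u : H10 D} (hu : normH u = 1) (v w : H10 D) :
    formJ κ Ω W σ u v w = (linForm Ω W v w).re
      + κ * (∫ x in D, (fn u x * conj (fn v x) + 2 * fn v x * conj (fn u x))
          * fn u x * conj (fn w x)).re
      - 2 * κ * (innerH u v * (∫ x in D, ((‖fn u x‖ ^ 2 : ℝ) : ℂ) * fn u x * conj (fn w x)).re)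
      + σ * innerH v w := by
  unfold formJ fullJ
  rw [Complex.sub_re, Complex.add_re, Complex.re_ofReal_mul, Complex.re_ofReal_mul, hu]
  simp only [one_pow, div_one, mul_assoc]

lemma opA_of_normH_eq_one (κ : ℝ) {u : H10 D} (hu : normH u = 1) (v : H10 D) :
    opA κ Ω W u u v = (linForm Ω W u v).re
      + κ * (∫ x in D, ((‖fn u x‖ ^ 2 : ℝ) : ℂ) * fn u x * conj (fn v x)).re := by
  unfold opA
  rw [Complex.add_re, Complex.re_ofReal_mul, hu]
  simp only [one_pow, div_one]

namespace Represents

variable {F : EnergyForms (H10 D) (Lp ℝ 2 (volume.restrict D))}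

lemma re_integral_norm_sq_mul_eq (hF : Represents F Ω W) (u v w : H10 D) :
    (∫ x in D, ((‖fn u x‖ ^ 2 : ℝ) : ℂ) * fn v x * conj (fn w x)).re = F.PForm u u v w :=
  (re_integral_norm_sq_mul (hF.memLp_fn u) (hF.memLp_fn v) (hF.memLp_fn w)).trans
    (hF.PForm_eq u u v w).symm

lemma formJ_eq (hF : Represents F Ω W) (κ σ : ℝ) {u : H10 D} (hu : normH u = 1) (v w : H10 D) :
    formJ κ Ω W σ u v w = F.JForm κ σ u v w := by
  have h := (re_integral_linearization (hF.memLp_fn u) (hF.memLp_fn v) (hF.memLp_fn w)).trans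
    (congrArg₂ (fun s t => 2 * s + t) (hF.PForm_eq u v u w).symm (hF.PForm_eq u u v w).symm)
  exact (formJ_of_normH_eq_one κ σ hu v w).trans (linearization_congr (hF.re_linForm_eq v w) h
    (hF.re_integral_norm_sq_mul_eq u u w) (hF.innerH_eq u v) (hF.innerH_eq v w) κ σ)

lemma opA_eq (hF : Represents F Ω W) (κ : ℝ) {u : H10 D} (hu : normH u = 1) (v : H10 D) :
    opA κ Ω W u u v = F.denergy κ u v := by
  exact (opA_of_normH_eq_one κ hu v).trans ((congrArg₂ (fun s t => s + κ * t)
    (hF.re_linForm_eq u v) (hF.re_integral_norm_sq_mul_eq u u v)).trans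
    (F.denergy_eq_forms κ u v).symm)

lemma energy_eq (hF : Represents F Ω W) (κ : ℝ) (u : H10 D) :
    energy κ Ω W u = F.energy κ u := by
  have hu := hF.memLp_fn u
  exact (energy_eq_integral κ u).trans
    ((half_mul_integral_add (hF.integrable u) (integrable_re_mul_re hu hu hu hu) κ).trans
      ((congrArg₂ (fun s t => 1 / 2 * s + κ / 4 * t) (hF.aForm_self_eq u).symm
        (hF.PForm_eq u u u u).symm).trans (F.energy_eq_forms κ u).symm))

lemma normH_eq (hF : Represents F Ω W) (u : H10 D) : normH u = √(F.mForm u u) := by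
  rw [← hF.innerH_eq, ← inner_toL2, real_inner_self_eq_norm_sq, Real.sqrt_sq (norm_nonneg _),
    toL2_apply]
  rfl

lemma normH_eq_one_iff (hF : Represents F Ω W) (u : H10 D) :
    normH u = 1 ↔ F.mForm u u = 1 := by
  rw [hF.normH_eq, Real.sqrt_eq_one]

lemma intermediate_eq (hF : Represents F Ω W) (τ : ℝ) (u w : H10 D) :
    intermediate τ u w = F.dampedPoint τ u w := by
  unfold intermediate
  rw [hF.innerH_eq]
  rfl

lemma isDampedJStep_iff (hF : Represents F Ω W) (κ σ τ : ℝ) {u : H10 D} (hu : normH u = 1)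
    (u' : H10 D) : IsDampedJStep κ Ω W σ τ u u' ↔
      JInvertible κ Ω W σ u ∧ F.IsStep κ σ τ u u' := by
  unfold IsDampedJStep EnergyForms.IsStep EnergyForms.normalized
  simp only [hF.formJ_eq κ σ hu, hF.innerH_eq, hF.intermediate_eq, hF.normH_eq]

lemma jInvertible (hF : Represents F Ω W) {κ σ e : ℝ} (hκ : 0 ≤ κ) {u : H10 D}
    (hu : normH u = 1) (he : F.energy κ u ≤ e) (hσ : 4 / 3 * e ≤ σ) :
    JInvertible κ Ω W σ u := by
  obtain ⟨J, hJ⟩ := F.exists_JForm_equiv hκ ((hF.normH_eq_one_iff u).1 hu) he hσ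
  exact ⟨J, fun v w => (hJ v w).trans (hF.formJ_eq κ σ hu v w).symm⟩

lemma isEigenstate (hF : Represents F Ω W) {κ : ℝ} {u : H10 D} (hu : normH u = 1)
    (h : ∃ eig : ℝ, ∀ v, F.denergy κ u v = eig * F.mForm u v) : IsEigenstate κ Ω W u := by
  obtain ⟨eig, h⟩ := h
  exact ⟨hu, eig, fun v => by rw [hF.opA_eq κ hu, h, hF.innerH_eq]⟩

lemma isCriticalPoint (hF : Represents F Ω W) {κ : ℝ} {u : H10 D} (hu : normH u = 1)
    (h : ∃ eig : ℝ, ∀ v, F.denergy κ u v = eig * F.mForm u v) : IsCriticalPoint κ Ω W u := by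
  obtain ⟨eig, h⟩ := h
  refine ⟨hu, fun v hv => ?_⟩
  have h0 : F.denergy κ u v = 0 :=
    (h v).trans ((congrArg (eig * ·) ((hF.innerH_eq u v).symm.trans hv)).trans (mul_zero eig))
  exact (F.hasDerivAt_of_eq_energy (hF.energy_eq κ) u v).congr_deriv h0

lemma existsUnique_isDampedJStep (hF : Represents F Ω W) {κ σ e S K τ : ℝ} (hκ : 0 ≤ κ)
    {u : H10 D} (hu : normH u = 1) (he : energy κ Ω W u ≤ e) (hσ : 4 / 3 * e ≤ σ)
    (hS : F.DensityBound S) (hK : κ * S ^ 2 * (4 * e) ≤ K) (hτ : 0 < τ)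
    (hτK : τ * (2 * (1 + K)) ≤ 1) : ∃! u' : H10 D, IsDampedJStep κ Ω W σ τ u u' := by
  rw [hF.energy_eq] at he
  obtain ⟨u', h, h'⟩ :=
    F.existsUnique_isStep hκ ((hF.normH_eq_one_iff u).1 hu) he hσ hS hK hτ hτK
  exact ⟨u', (hF.isDampedJStep_iff κ σ τ hu u').2 ⟨hF.jInvertible hκ hu he hσ, h⟩,
    fun y hy => h' y ((hF.isDampedJStep_iff κ σ τ hu y).1 hy).2⟩

lemma isDampedJStep_spec (hF : Represents F Ω W) {κ σ e S K τ : ℝ} (hκ : 0 ≤ κ)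
    {u u' : H10 D} (hu : normH u = 1) (he : energy κ Ω W u ≤ e) (hσ : 4 / 3 * e ≤ σ)
    (hS : F.DensityBound S) (hK : κ * S ^ 2 * (4 * e) ≤ K) (hτ : 0 < τ)
    (hτK : τ * (2 * (1 + K)) ≤ 1) (h : IsDampedJStep κ Ω W σ τ u u') :
    normH u' = 1 ∧ energy κ Ω W u' ≤ energy κ Ω W u ∧
      (¬ (IsCriticalPoint κ Ω W u ∧ IsEigenstate κ Ω W u) →
        energy κ Ω W u' < energy κ Ω W u) := by
  rw [hF.energy_eq] at he
  obtain ⟨h1, h2, h3⟩ := ((hF.isDampedJStep_iff κ σ τ hu u').1 h).2.spec hκ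
    ((hF.normH_eq_one_iff u).1 hu) he hσ hS hK hτ hτK
  rw [hF.energy_eq, hF.energy_eq]
  exact ⟨(hF.normH_eq_one_iff u').2 h1, h2, fun hne => h3 fun heig =>
    hne ⟨hF.isCriticalPoint hu heig, hF.isEigenstate hu heig⟩⟩

end Represents

end Representation

end GPE

end

/-! ### The main theorem -/

theorem mainTheorem3 (d : ℕ) [NeZero d] (hd : d = 2 ∨ d = 3)
    (D : Set (GPE.Pt d)) (hDo : IsOpen D) (hDb : Bornology.IsBounded D)
    (u₀ : GPE.H10 D) (hu₀ : GPE.normH u₀ = 1) (e : ℝ) :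
    ∃ τstar : ℝ, 0 < τstar ∧
      ∀ (κ Ω : ℝ) (W : GPE.Pt d → ℝ) (σ : ℝ) (τ : ℕ → ℝ),
        0 ≤ κ →
        MemLp W ⊤ (volume.restrict D) →
        (∀ᵐ x ∂(volume.restrict D), Ω ^ 2 * ‖GPE.rotField x‖ ^ 2 ≤ W x) →
        GPE.energy κ Ω W u₀ = e →
        4 / 3 * GPE.energy κ Ω W u₀ ≤ σ →
        (∀ n, 0 < τ n ∧ τ n ≤ τstar) →
        (∃! u : ℕ → GPE.H10 D, GPE.IsDampedJSequence κ Ω W σ τ u₀ u) ∧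
        ∀ u : ℕ → GPE.H10 D, GPE.IsDampedJSequence κ Ω W σ τ u₀ u →
          ∀ n,
            GPE.energy κ Ω W (u (n + 1)) ≤ GPE.energy κ Ω W (u n) ∧
            GPE.energy κ Ω W (u n) ≤ GPE.energy κ Ω W u₀ ∧
            (¬ (GPE.IsCriticalPoint κ Ω W (u n) ∧ GPE.IsEigenstate κ Ω W (u n)) →
              GPE.energy κ Ω W (u (n + 1)) < GPE.energy κ Ω W (u n)) := by
  obtain ⟨S, p, hp, hrep⟩ := GPE.exists_represents_of_domain (u₀ := u₀) hd hDo hDb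
    (by rw [hu₀]; exact one_ne_zero)
  -- This is κ S² (4e) with κ replaced by its bound 4e / p. It is a multiple of e², hence
  -- nonnegative even before e ≥ 0 is known.
  set K : ℝ := 4 * e / p * S ^ 2 * (4 * e) with hK_def
  have hK0 : 0 ≤ K := by
    have : K = 16 * e ^ 2 * S ^ 2 / p := by rw [hK_def]; ring
    rw [this]
    positivity
  refine ⟨(2 * (1 + K))⁻¹, by positivity, fun κ Ω W σ τ hκ hWm hW he hσ hτ => ?_⟩
  obtain ⟨F, hF, hS, hFp⟩ := hrep Ω W hWm hW
  have he0 : 0 ≤ e := by rw [← he, hF.energy_eq]; exact F.energy_nonneg hκ u₀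
  have hκp : κ ≤ 4 * e / p := by
    rw [le_div_iff₀ hp, ← hFp, ← he, hF.energy_eq]
    exact F.mul_PForm_le_energy κ u₀
  have hK : κ * S ^ 2 * (4 * e) ≤ K := by rw [hK_def]; gcongr
  have hτK (n : ℕ) : τ n * (2 * (1 + K)) ≤ 1 :=
    (le_inv_mul_iff₀' (by positivity)).1 (by rw [mul_one]; exact (hτ n).2)
  rw [he] at hσ
  have hstep (n : ℕ) (x y : GPE.H10 D) (hx : GPE.normH x = 1 ∧ GPE.energy κ Ω W x ≤ e)
      (h : GPE.IsDampedJStep κ Ω W σ (τ n) x y) :=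
    hF.isDampedJStep_spec hκ hx.1 hx.2 hσ hS hK (hτ n).1 (hτK n) h
  -- The invariant is unit mass together with energy at most e; it keeps σ and the step bound
  -- admissible at every iterate.
  refine ⟨GPE.EnergyForms.existsUnique_seq
    (I := fun x => GPE.normH x = 1 ∧ GPE.energy κ Ω W x ≤ e)
    (R := fun n x y => GPE.IsDampedJStep κ Ω W σ (τ n) x y) ⟨hu₀, he.le⟩
    (fun n x hx => hF.existsUnique_isDampedJStep hκ hx.1 hx.2 hσ hS hK (hτ n).1 (hτK n))
    (fun n x y hx h => ⟨(hstep n x y hx h).1, (hstep n x y hx h).2.1.trans hx.2⟩), ?_⟩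
  intro u hu n
  have hI (n : ℕ) : GPE.normH (u n) = 1 ∧ GPE.energy κ Ω W (u n) ≤ e := by
    induction n with
    | zero => rw [hu.1]; exact ⟨hu₀, he.le⟩
    | succ n ih =>
      have h := hstep n _ _ ih (hu.2 n)
      exact ⟨h.1, h.2.1.trans ih.2⟩
  have h := hstep n _ _ (hI n) (hu.2 n)
  exact ⟨h.2.1, he ▸ (hI n).2, h.2.2⟩
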